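/- Let $M$ be a smooth manifold (Hausdorff, second countable, without boundary) and $E\to M$ a smooth real vector bundle of rank $n>1$, with space of smooth sections $\Gamma(E)$. For $u\in C^\infty(M)$ let $\gamma_u\in \mathrm{End}_{\mathbb R}(\Gamma(E))$ be multiplication by $u$. Put $\mathcal P^{0}(E,M)=\{\gamma_u : u\in C^\infty(M)\}$ and, for $k\ge 0$, $\mathcal P^{k+1}(E,M)=\{T\in \mathrm{End}_{\mathbb R}(\Gamma(E)) : [T,\gamma_u]\in\mathcal P^{k}(E,M)\ \text{for all } u\in C^\infty(M)\}$, and $\mathcal P^{-1}(E,M)=0$. Let $\mathcal S^k(\mathcal P(E,M))=\mathcal P^k(E,M)/\mathcal P^{k-1}(E,M)$ and let $\mathcal S(\mathcal P(E,M))=\bigoplus_{k\ge 0}\mathcal S^k(\mathcal P(E,M))$ be the commutative $\mathbb R$-algebra whose product is induced by composition of operators, $\mathcal S^k\times \mathcal S^l\to \mathcal S^{k+l}$. Let $\mathrm{Pol}(T^*M)=\bigoplus_{k\ge0}\mathrm{Pol}^k(T^*M)$, where $\mathrm{Pol}^k(T^*M)$ is the space of smooth functions on $T^*M$ whose restriction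 to each fibre is a homogeneous polynomial of degree $k$. Let $\mathcal S(M)$ be the algebra defined as $\mathcal S(\mathcal P(E,M))$ is, with $C^\infty(M)$ in place of $\Gamma(E)$ (symbols of scalar differential operators). Say that $p\in\mathrm{Pol}^k(T^*M)$ is the principal symbol of order $k$ of $T$ if for every $u\in C^\infty(M)$ the $k$-fold commutator $[\dots[[T,\gamma_u],\gamma_u]\dots,\gamma_u]$ is multiplication by the function $x\mapsto k!\,p(x,d_xu)$. Then: 1. Taking principal symbols defines an isomorphism of $\mathbb R$-algebras $\mathcal S(M)\cong \mathrm{Pol}(T^*M)$. 2. There is exactly one homomorphism of $\mathbb R$-algebras $\delta:\mathcal S(\mathcal P(E,M))\to\mathrm{Pol}(T^*M)$ which, for every $k\geq 0$ and $T\in\mathcal P^k(E,M)$, maps the class of $T$ in $\mathcal S^k(\mathcal P(E,M))$ to the principal symbol of order $k$ of $T$. It is surjective. 3. The set $\mathcal J(E)=\{P\in\mathcal S(\mathcal P(E,M)) : P^2=0\}$ is an ideal of $\mathcal S(\mathcal P(E,M))$, the product of any two of its elements is $0$, and $\mathcal J(E)=\ker\delta$. 4. There is a graded homomorphism of $\mathbb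 R$-algebras $\sigma:\mathrm{Pol}(T^*M)\to\mathcal S(\mathcal P(E,M))$ with $\delta\circ\sigma=\mathrm{id}$. Identifying $\mathrm{Pol}(T^*M)$ with the subalgebra $\sigma(\mathrm{Pol}(T^*M))$, one has, as a direct sum of vector spaces, $$\mathcal S(\mathcal P(E,M))=\mathcal J(E)\oplus\mathrm{Pol}(T^*M).$$ -/

import Mathlib

open scoped Manifold ContDiff Bundle DirectSum

noncomputable section

/-! ### The quantum Poisson algebra of an `A`-module and its algebra of symbols

`K` is the ground ring, `A` a commutative `K`-algebra, `Γ` an `A`-module. In the geometric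
situation below, `K = ℝ`, `A` is the algebra of smooth functions on a manifold, and `Γ` is the
space of smooth sections of a vector bundle. -/

namespace SymbolAlgebra

section Algebraic

variable (K A Γ : Type*) [CommRing K] [CommRing A] [Algebra K A] [AddCommGroup Γ] [Module K Γ]
  [Module A Γ] [IsScalarTower K A Γ]

/-- `γ u : Γ → Γ`, `s ↦ u • s`, the operator of multiplication by `u ∈ A`. -/
abbrev γ : A →ₐ[K] Module.End K Γ := Algebra.lsmul K K Γ

/-- The filtration `P⁰ ⊆ P¹ ⊆ …`: `P⁰ = {γ u}` and
`P^(k+1) = {T | ∀ u, [T, γ u] ∈ P^k}`. -/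
def diffOp : ℕ → Submodule K (Module.End K Γ)
  | 0 => LinearMap.range (γ K A Γ).toLinearMap
  | k + 1 =>
    { carrier := {T | ∀ u : A, T * γ K A Γ u - γ K A Γ u * T ∈ diffOp k}
      add_mem' := fun {S T} hS hT u => by
        have h := (diffOp k).add_mem (hS u) (hT u)
        rwa [show (S + T) * γ K A Γ u - γ K A Γ u * (S + T)
          = (S * γ K A Γ u - γ K A Γ u * S) + (T * γ K A Γ u - γ K A Γ u * T) by noncomm_ring]
      zero_mem' := fun u => by simp
      smul_mem' := fun c T hT u => by
        have h := (diffOp k).smul_mem c (hT u)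
        rwa [show (c • T) * γ K A Γ u - γ K A Γ u * (c • T)
          = c • (T * γ K A Γ u - γ K A Γ u * T) by
            rw [smul_mul_assoc, mul_smul_comm, smul_sub]] }

/-- `P^(k-1)`, where `P^(-1) = 0`. -/
def diffOpBelow : ℕ → Submodule K (Module.End K Γ)
  | 0 => ⊥
  | k + 1 => diffOp K A Γ k

variable {K A Γ}

theorem mem_diffOp_zero {T : Module.End K Γ} :
    T ∈ diffOp K A Γ 0 ↔ ∃ u : A, γ K A Γ u = T := Iff.rfl

theorem mem_diffOp_succ {k : ℕ} {T : Module.End K Γ} :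
    T ∈ diffOp K A Γ (k + 1) ↔ ∀ u : A, T * γ K A Γ u - γ K A Γ u * T ∈ diffOp K A Γ k :=
  Iff.rfl

theorem γ_comm (u v : A) : γ K A Γ u * γ K A Γ v = γ K A Γ v * γ K A Γ u := by
  rw [← map_mul, mul_comm, map_mul]

theorem bracket_mem_below {k : ℕ} {T : Module.End K Γ} (hT : T ∈ diffOp K A Γ k) (u : A) :
    T * γ K A Γ u - γ K A Γ u * T ∈ diffOpBelow K A Γ k := by
  cases k with
  | zero =>
    obtain ⟨v, rfl⟩ := hT
    change γ K A Γ v * γ K A Γ u - γ K A Γ u * γ K A Γ v ∈ (⊥ : Submodule K _)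
    simp [γ_comm v u]
  | succ k => exact hT u

theorem diffOp_le_succ (k : ℕ) : diffOp K A Γ k ≤ diffOp K A Γ (k + 1) := by
  induction k with
  | zero =>
    intro T hT u
    have h := bracket_mem_below hT u
    rw [show _ = (0 : Module.End K Γ) from h]
    exact Submodule.zero_mem _
  | succ k ih => exact fun T hT u => ih (hT u)

theorem diffOpBelow_le (k : ℕ) : diffOpBelow K A Γ k ≤ diffOp K A Γ k := by
  cases k with
  | zero => exact bot_le
  | succ k => exact diffOp_le_succ k

theorem mul_mem_diffOp {i j : ℕ} {S T : Module.End K Γ} (hS : S ∈ diffOp K A Γ i)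
    (hT : T ∈ diffOp K A Γ j) : S * T ∈ diffOp K A Γ (i + j) := by
  suffices H : ∀ n i j : ℕ, i + j = n → ∀ S T : Module.End K Γ, S ∈ diffOp K A Γ i →
      T ∈ diffOp K A Γ j → S * T ∈ diffOp K A Γ n from H _ i j rfl S T hS hT
  clear hS hT S T i j
  intro n
  induction n with
  | zero =>
    intro i j hij S T hS hT
    obtain ⟨rfl, rfl⟩ : i = 0 ∧ j = 0 := by omega
    obtain ⟨u, rfl⟩ := hS
    obtain ⟨v, rfl⟩ := hT
    exact ⟨u * v, map_mul (γ K A Γ) u v⟩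
  | succ n ih =>
    intro i j hij S T hS hT u
    rw [show S * T * γ K A Γ u - γ K A Γ u * (S * T)
      = S * (T * γ K A Γ u - γ K A Γ u * T) + (S * γ K A Γ u - γ K A Γ u * S) * T by
        noncomm_ring]
    have h1 := bracket_mem_below hS u
    have h2 := bracket_mem_below hT u
    refine Submodule.add_mem _ ?_ ?_
    · cases j with
      | zero =>
        rw [show _ = (0 : Module.End K Γ) from h2, mul_zero]
        exact Submodule.zero_mem _
      | succ j => exact ih i j (by omega) _ _ hS h2
    · cases i with
      | zero =>
        rw [show _ = (0 : Module.End K Γ) from h1, zero_mul]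
        exact Submodule.zero_mem _
      | succ i => exact ih i j (by omega) _ _ h1 hT

theorem mul_mem_below_left {i j : ℕ} {S T : Module.End K Γ} (hS : S ∈ diffOpBelow K A Γ i)
    (hT : T ∈ diffOp K A Γ j) : S * T ∈ diffOpBelow K A Γ (i + j) := by
  cases i with
  | zero =>
    rw [show S = (0 : Module.End K Γ) from hS, zero_mul]
    exact Submodule.zero_mem _
  | succ i =>
    rw [show i + 1 + j = (i + j) + 1 by omega]
    exact mul_mem_diffOp (i := i) hS hT

theorem mul_mem_below_right {i j : ℕ} {S T : Module.End K Γ} (hS : S ∈ diffOp K A Γ i)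
    (hT : T ∈ diffOpBelow K A Γ j) : S * T ∈ diffOpBelow K A Γ (i + j) := by
  cases j with
  | zero =>
    rw [show T = (0 : Module.End K Γ) from hT, mul_zero]
    exact Submodule.zero_mem _
  | succ j => exact mul_mem_diffOp (j := j) hS hT

theorem commutator_mem_below {i j : ℕ} {S T : Module.End K Γ} (hS : S ∈ diffOp K A Γ i)
    (hT : T ∈ diffOp K A Γ j) : S * T - T * S ∈ diffOpBelow K A Γ (i + j) := by
  suffices H : ∀ n i j : ℕ, i + j = n → ∀ S T : Module.End K Γ, S ∈ diffOp K A Γ i →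
      T ∈ diffOp K A Γ j → S * T - T * S ∈ diffOpBelow K A Γ n from H _ i j rfl S T hS hT
  clear hS hT S T i j
  intro n
  induction n with
  | zero =>
    intro i j hij S T hS hT
    obtain ⟨rfl, rfl⟩ : i = 0 ∧ j = 0 := by omega
    obtain ⟨v, rfl⟩ := hT
    exact bracket_mem_below hS v
  | succ n ih =>
    intro i j hij S T hS hT
    change S * T - T * S ∈ diffOp K A Γ n
    have h1 := fun u => bracket_mem_below hS u
    have h2 := fun u => bracket_mem_below hT u
    cases i with
    | zero =>
      obtain ⟨v, rfl⟩ := hS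
      obtain rfl : j = n + 1 := by omega
      change γ K A Γ v * T - T * γ K A Γ v ∈ diffOp K A Γ n
      rw [← neg_sub]
      exact Submodule.neg_mem _ (hT v)
    | succ i =>
      cases j with
      | zero =>
        obtain ⟨v, rfl⟩ := hT
        obtain rfl : i = n := by omega
        exact hS v
      | succ j =>
        cases n with
        | zero => omega
        | succ n =>
          intro u
          rw [show (S * T - T * S) * γ K A Γ u - γ K A Γ u * (S * T - T * S)
            = (S * (T * γ K A Γ u - γ K A Γ u * T) - (T * γ K A Γ u - γ K A Γ u * T) * S)
              + ((S * γ K A Γ u - γ K A Γ u * S) * T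
                - T * (S * γ K A Γ u - γ K A Γ u * S)) by noncomm_ring]
          exact Submodule.add_mem _ (ih (i + 1) j (by omega) _ _ hS (h2 u))
            (ih i (j + 1) (by omega) _ _ (h1 u) hT)

variable (K A Γ)

/-- `S^k = P^k / P^(k-1)`. -/
def SymbolSpace (k : ℕ) : Type _ :=
  diffOp K A Γ k ⧸ (diffOpBelow K A Γ k).submoduleOf (diffOp K A Γ k)

instance (k : ℕ) : AddCommGroup (SymbolSpace K A Γ k) :=
  inferInstanceAs
    (AddCommGroup (diffOp K A Γ k ⧸ (diffOpBelow K A Γ k).submoduleOf (diffOp K A Γ k)))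

instance (k : ℕ) : Module K (SymbolSpace K A Γ k) :=
  inferInstanceAs
    (Module K (diffOp K A Γ k ⧸ (diffOpBelow K A Γ k).submoduleOf (diffOp K A Γ k)))

variable {K A Γ}

/-- The symbol of degree `k` of an element of `P^k`, that is, its class modulo `P^(k-1)`. -/
def symbol {k : ℕ} : diffOp K A Γ k →ₗ[K] SymbolSpace K A Γ k :=
  Submodule.mkQ ((diffOpBelow K A Γ k).submoduleOf (diffOp K A Γ k))

theorem symbol_surjective {k : ℕ} :
    Function.Surjective (symbol : diffOp K A Γ k →ₗ[K] SymbolSpace K A Γ k) :=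
  Submodule.Quotient.mk_surjective _

theorem symbol_eq_zero_iff {k : ℕ} {T : diffOp K A Γ k} :
    symbol T = 0 ↔ T.1 ∈ diffOpBelow K A Γ k :=
  Submodule.Quotient.mk_eq_zero _

theorem symbol_eq_iff {k : ℕ} {S T : diffOp K A Γ k} :
    symbol S = symbol T ↔ S.1 - T.1 ∈ diffOpBelow K A Γ k :=
  Submodule.Quotient.eq _

/-- Composition `P^i × P^j → P^(i+j)`. -/
def compDiffOp (i j : ℕ) : diffOp K A Γ i →ₗ[K] diffOp K A Γ j →ₗ[K] diffOp K A Γ (i + j) :=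
  LinearMap.mk₂ K (fun S T => ⟨S.1 * T.1, mul_mem_diffOp S.2 T.2⟩)
    (fun S S' T => Subtype.ext (add_mul S.1 S'.1 T.1))
    (fun c S T => Subtype.ext (smul_mul_assoc c S.1 T.1))
    (fun S T T' => Subtype.ext (mul_add S.1 T.1 T'.1))
    (fun c S T => Subtype.ext (mul_smul_comm c S.1 T.1))

/-- The product of symbols: `symbol S * symbol T` is the symbol of degree `i + j` of `S ∘ T`. -/
def symbolMul (i j : ℕ) :
    SymbolSpace K A Γ i →ₗ[K] SymbolSpace K A Γ j →ₗ[K] SymbolSpace K A Γ (i + j) :=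
  Submodule.liftQ _
    (LinearMap.flip (Submodule.liftQ _
      (LinearMap.flip ((compDiffOp i j).compr₂ symbol))
      (fun T hT => LinearMap.ext fun S =>
        symbol_eq_zero_iff.2 (mul_mem_below_right S.2 hT))))
    (fun S hS => LinearMap.ext fun q => by
      obtain ⟨T, rfl⟩ := symbol_surjective q
      exact symbol_eq_zero_iff.2 (mul_mem_below_left hS T.2))

theorem symbolMul_symbol {i j : ℕ} (S : diffOp K A Γ i) (T : diffOp K A Γ j) :
    symbolMul i j (symbol S) (symbol T) = symbol ⟨S.1 * T.1, mul_mem_diffOp S.2 T.2⟩ := rfl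

theorem gradedMk_eq {i j : ℕ} (h : i = j) (S : diffOp K A Γ i) (T : diffOp K A Γ j)
    (hST : S.1 - T.1 ∈ diffOpBelow K A Γ i) :
    GradedMonoid.mk (A := SymbolSpace K A Γ) i (symbol S) = GradedMonoid.mk j (symbol T) := by
  subst h
  exact congrArg _ (symbol_eq_iff.2 hST)

theorem gradedMk_congr {i j : ℕ} (h : i = j) (S : diffOp K A Γ i) (T : diffOp K A Γ j)
    (hST : S.1 = T.1) :
    GradedMonoid.mk (A := SymbolSpace K A Γ) i (symbol S) = GradedMonoid.mk j (symbol T) :=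
  gradedMk_eq h S T (by rw [hST, sub_self]; exact Submodule.zero_mem _)

theorem γ_mem (u : A) : γ K A Γ u ∈ diffOp K A Γ 0 := ⟨u, rfl⟩

instance : GradedMonoid.GMul (SymbolSpace K A Γ) where
  mul {i j} p q := symbolMul i j p q

instance : GradedMonoid.GOne (SymbolSpace K A Γ) where
  one := symbol ⟨γ K A Γ 1, γ_mem 1⟩

instance : DirectSum.GCommRing (SymbolSpace K A Γ) where
  mul_zero p := map_zero _
  zero_mul q := by change symbolMul _ _ 0 q = 0; simp
  mul_add p q r := map_add _ q r
  add_mul p q r := by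
    change symbolMul _ _ (p + q) r = symbolMul _ _ p r + symbolMul _ _ q r
    simp
  one_mul := by
    rintro ⟨i, p⟩
    obtain ⟨S, rfl⟩ := symbol_surjective p
    exact gradedMk_congr (zero_add i) _ S (show γ K A Γ 1 * S.1 = S.1 by rw [map_one, one_mul])
  mul_one := by
    rintro ⟨i, p⟩
    obtain ⟨S, rfl⟩ := symbol_surjective p
    exact gradedMk_congr (add_zero i) _ S (show S.1 * γ K A Γ 1 = S.1 by rw [map_one, mul_one])
  mul_assoc := by
    rintro ⟨i, p⟩ ⟨j, q⟩ ⟨k, r⟩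
    obtain ⟨S, rfl⟩ := symbol_surjective p
    obtain ⟨T, rfl⟩ := symbol_surjective q
    obtain ⟨U, rfl⟩ := symbol_surjective r
    exact gradedMk_congr (add_assoc i j k) _ _ (mul_assoc S.1 T.1 U.1)
  mul_comm := by
    rintro ⟨i, p⟩ ⟨j, q⟩
    obtain ⟨S, rfl⟩ := symbol_surjective p
    obtain ⟨T, rfl⟩ := symbol_surjective q
    exact gradedMk_eq (add_comm i j) _ _ (commutator_mem_below S.2 T.2)
  natCast n := symbol ⟨γ K A Γ n, γ_mem _⟩
  natCast_zero := symbol_eq_zero_iff.2 (by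
    change γ K A Γ ((0 : ℕ) : A) ∈ diffOpBelow K A Γ 0
    rw [Nat.cast_zero, map_zero]
    exact Submodule.zero_mem _)
  natCast_succ n := by
    change symbol _ = symbol _ + symbol _
    rw [← map_add]
    congr 1
    exact Subtype.ext (by simp)
  intCast n := symbol ⟨γ K A Γ n, γ_mem _⟩
  intCast_ofNat n := by
    congr 1
    exact Subtype.ext (by simp)
  intCast_negSucc_ofNat n := by
    rw [← map_neg]
    congr 1
    exact Subtype.ext (by simp)

instance : DirectSum.GAlgebra K (SymbolSpace K A Γ) where
  toFun :=
    { toFun := fun c => symbol ⟨γ K A Γ (algebraMap K A c), γ_mem _⟩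
      map_zero' := symbol_eq_zero_iff.2 (by
        change γ K A Γ (algebraMap K A 0) ∈ diffOpBelow K A Γ 0
        rw [map_zero, map_zero]
        exact Submodule.zero_mem _)
      map_add' := fun c d => by
        rw [← map_add]
        congr 1
        exact Subtype.ext (by simp) }
  map_one := by
    change symbol _ = symbol _
    congr 1
    exact Subtype.ext (by simp)
  map_mul c d := gradedMk_congr (zero_add 0).symm _ _
    (show γ K A Γ (algebraMap K A (c * d))
      = γ K A Γ (algebraMap K A c) * γ K A Γ (algebraMap K A d) by simp only [map_mul])
  commutes := by
    rintro c ⟨i, p⟩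
    exact mul_comm _ _
  smul_def := by
    rintro c ⟨i, p⟩
    obtain ⟨S, rfl⟩ := symbol_surjective p
    exact gradedMk_congr (zero_add i).symm (c • S) _
      (show (c • S).1 = γ K A Γ (algebraMap K A c) * S.1 by ext s; simp)

variable (K A Γ)

/-- The algebra of symbols `⨁ k, P^k / P^(k-1)`, a commutative `K`-algebra. -/
abbrev Symbols : Type _ := ⨁ k : ℕ, SymbolSpace K A Γ k

variable {K A Γ}

/-- The iterated commutator `[…[[T, γ u], γ u]…, γ u]` with `k` brackets. -/
def iterBracket (u : A) (k : ℕ) (T : Module.End K Γ) : Module.End K Γ :=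
  (fun D => D * γ K A Γ u - γ K A Γ u * D)^[k] T

end Algebraic

/-! ### Smooth functions, sections and fibrewise polynomial functions on the cotangent bundle -/

section Geometric

/-- `C^∞(M)`. -/
abbrev SmoothFun (m : ℕ) (M : Type*) [TopologicalSpace M]
    [ChartedSpace (EuclideanSpace ℝ (Fin m)) M] : Type _ := C^∞⟮𝓡 m, M; 𝓘(ℝ, ℝ), ℝ⟯

variable {m : ℕ} {M : Type*} [TopologicalSpace M] [ChartedSpace (EuclideanSpace ℝ (Fin m)) M]

section Sections

variable (m) (F : Type*) [NormedAddCommGroup F] [NormedSpace ℝ F] (V : M → Type*)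
  [TopologicalSpace (Bundle.TotalSpace F V)] [∀ x, AddCommGroup (V x)] [∀ x, Module ℝ (V x)]
  [∀ x, TopologicalSpace (V x)] [FiberBundle F V] [VectorBundle ℝ F V]

/-- `Γ(V)`, the space of smooth sections. -/
abbrev SmoothSec : Type _ := Cₛ^∞⟮𝓡 m; F, V⟯

/-- Pointwise multiplication of a section by a function. -/
instance : Module (SmoothFun m M) (SmoothSec m F V) where
  smul f s := ⟨fun x => f x • s x, f.contMDiff.smul_section s.contMDiff⟩
  one_smul s := ContMDiffSection.ext fun x => one_smul ℝ (s x)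
  mul_smul f g s := ContMDiffSection.ext fun x => mul_smul (f x) (g x) (s x)
  smul_zero f := ContMDiffSection.ext fun x => smul_zero (f x)
  smul_add f s t := ContMDiffSection.ext fun x => smul_add (f x) (s x) (t x)
  add_smul f g s := ContMDiffSection.ext fun x => add_smul (f x) (g x) (s x)
  zero_smul s := ContMDiffSection.ext fun x => zero_smul ℝ (s x)

instance : IsScalarTower ℝ (SmoothFun m M) (SmoothSec m F V) where
  smul_assoc c f s := ContMDiffSection.ext fun x => smul_assoc c (f x) (s x)

end Sections

variable [IsManifold (𝓡 m) ∞ M]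

variable (m M) in
/-- The total space of the cotangent bundle `T*M`. -/
abbrev CotangentBundle : Type _ :=
  Bundle.TotalSpace (EuclideanSpace ℝ (Fin m) →L[ℝ] ℝ)
    (fun x : M => TangentSpace (𝓡 m) x →L[ℝ] ℝ)

variable (m M) in
/-- `C^∞(T*M)`. -/
abbrev CotangentFun : Type _ :=
  C^∞⟮(𝓡 m).prod 𝓘(ℝ, EuclideanSpace ℝ (Fin m) →L[ℝ] ℝ), CotangentBundle m M; 𝓘(ℝ, ℝ), ℝ⟯

variable (m M) in
/-- `Pol^k(T*M)`: the smooth functions on `T*M` whose restriction to each fibre is a homogeneous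
polynomial of degree `k`, i.e. the restriction of a `k`-linear form to the diagonal. -/
def Pol (k : ℕ) : Submodule ℝ (CotangentFun m M) where
  carrier := {f | ∀ x : M,
    ∃ b : MultilinearMap ℝ (fun _ : Fin k => TangentSpace (𝓡 m) x →L[ℝ] ℝ) ℝ,
      ∀ ξ : TangentSpace (𝓡 m) x →L[ℝ] ℝ, f ⟨x, ξ⟩ = b fun _ => ξ}
  add_mem' {f g} hf hg x := by
    obtain ⟨b, hb⟩ := hf x
    obtain ⟨c, hc⟩ := hg x
    exact ⟨b + c, fun ξ => by simp [hb, hc]⟩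
  zero_mem' x := ⟨0, fun ξ => by simp⟩
  smul_mem' r f hf x := by
    obtain ⟨b, hb⟩ := hf x
    exact ⟨r • b, fun ξ => by simp [hb]⟩

instance : SetLike.GradedMonoid (Pol m M) where
  one_mem x := ⟨MultilinearMap.constOfIsEmpty ℝ _ 1, fun ξ => by simp⟩
  mul_mem {i j f g} hf hg x := by
    obtain ⟨b, hb⟩ := hf x
    obtain ⟨c, hc⟩ := hg x
    refine ⟨((LinearMap.mul' ℝ ℝ).compMultilinearMap (b.domCoprod c)).domDomCongr
      finSumFinEquiv, fun ξ => ?_⟩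
    simp [hb, hc]

variable (m M) in
/-- `Pol(T*M) = ⨁ k, Pol^k(T*M)`. -/
abbrev PolAlg : Type _ := ⨁ k : ℕ, Pol m M k

/-- `p ∈ Pol^k(T*M)` is the principal symbol of order `k` of `T`: for every smooth function `u`,
the iterated commutator `[…[T, γ u]…, γ u]` with `k` brackets is the operator of multiplication
by the function `x ↦ k! * p (x, du(x))`. -/
def IsPrincipalSymbol {Γ : Type*} [AddCommGroup Γ] [Module ℝ Γ] [Module (SmoothFun m M) Γ]
    [IsScalarTower ℝ (SmoothFun m M) Γ] (k : ℕ) (T : Module.End ℝ Γ) (p : Pol m M k) : Prop :=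
  ∀ u : SmoothFun m M, ∃ w : SmoothFun m M,
    iterBracket u k T = γ ℝ (SmoothFun m M) Γ w ∧
    ∀ x : M, w x = (k.factorial : ℝ) * (p : CotangentFun m M) ⟨x, mvfderiv (𝓡 m) u x⟩

/-- `δ` sends the class of `T ∈ P^k` modulo `P^(k-1)` to the principal symbol of order `k`
of `T`, an element of `Pol^k(T*M)`. -/
def IsPrincipalSymbolMap {Γ : Type*} [AddCommGroup Γ] [Module ℝ Γ] [Module (SmoothFun m M) Γ]
    [IsScalarTower ℝ (SmoothFun m M) Γ]
    (δ : Symbols ℝ (SmoothFun m M) Γ →ₐ[ℝ] PolAlg m M) : Prop :=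
  ∀ (k : ℕ) (T : diffOp ℝ (SmoothFun m M) Γ k), ∃ p : Pol m M k,
    IsPrincipalSymbol k (T : Module.End ℝ Γ) p ∧
    δ (DirectSum.of (SymbolSpace ℝ (SmoothFun m M) Γ) k (symbol T)) =
      DirectSum.of (fun i => Pol m M i) k p

end Geometric

end SymbolAlgebra

end

/-!
Write `ad u T = [T, γ u]`. The proof compares `P^k(E,M)`, the operators whose `k`-fold commutators
are multiplication operators, with the usual filtration: `orderLT k` is the space of operators
annihilated by all `k`-fold commutators, and `P^(k-1) ⊆ orderLT k ⊆ P^k`.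

*Existence of the principal symbol.* For `T ∈ P^k` the operator `(ad u)^k T` is multiplication by a
function of `u`. At each point this function is a homogeneous polynomial in the differential of `u`,
because commutators are derivations in their argument and point derivations factor through the
differential, by Hadamard's lemma (`IsSectionModule.isHomogeneousFunctional`). The polynomials fit
together to a smooth function on `T*M` by Euler's identity and induction on the degree
(`IsHomogeneousFunctional.contMDiff`). The top-degree Leibniz rule `ad_pow_mul` makes the principal
symbol multiplicative, which gives the homomorphism `δ` (`IsSectionModule.symbolHom`).

*The kernel of `δ`.* By polarization (`mem_orderLT_of_ad_pow_eq_zero`) the principal symbol of order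
`k` of `T` vanishes exactly when `T ∈ orderLT k`. If `S ∈ orderLT i` and `T ∈ orderLT j`, then
`S ∘ T ∈ orderLT (i + j - 1) ⊆ P^(i+j-1)`, so its class in degree `i + j` is zero
(`mul_mem_diffOpBelow_of_orderLT`): the kernel squares to zero. Conversely an element of square zero
is killed by `δ` because `Pol(T*M)` is reduced (`polAlg_eq_zero_of_sq`).

*The splitting.* Choose a connection `∇` and let `H` be the space of operators `∇_D + γ w`. The
operators whose `(k-1)`-fold commutators lie in `H` form a subspace `splitOp H k` of `P^k`; these
subspaces are multiplicative, and meet `orderLT k` inside `P^(k-1)`, since a bundle endomorphism in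
`H` is a multiplication operator (`IsHorizontal`). Every element of `Pol^k(T*M)` is the principal
symbol of an operator in `splitOp H k`: locally one takes sums of products of covariant derivatives,
by Euler's identity and induction, and then glues with a partition of unity
(`IsConnection.exists_splitOp`). Hence `δ` restricts to an isomorphism from the subalgebra of
classes of these operators onto `Pol(T*M)`, and the inverse is the graded section `σ`
(`IsConnection.splitHom`).

The argument is carried out for any module of sections with a connection, in the sense of
`IsSectionModule` and `IsConnection`, and applied twice: to sections of the bundle, and to
`C^∞(M)` with derivations acting as connection. In the second case every bundle endomorphism is a
multiplication operator, so `δ` is injective as well.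
-/

noncomputable section

open Bundle Topology

namespace SymbolAlgebra

/-! ### Commutator filtrations -/

section Filtrations

variable {K A Γ : Type*} [CommRing K] [CommRing A] [Algebra K A] [AddCommGroup Γ] [Module K Γ]
  [Module A Γ] [IsScalarTower K A Γ]

variable (K Γ) in
/-- The commutator with multiplication operators: `ad u T = [T, γ u]`, linear in `u` and `T`. -/
def ad : A →ₗ[K] Module.End K (Module.End K Γ) where
  toFun u := LinearMap.mulRight K (γ K A Γ u) - LinearMap.mulLeft K (γ K A Γ u)
  map_add' u v := by
    refine LinearMap.ext fun T => ?_
    simp only [map_add, LinearMap.sub_apply, LinearMap.add_apply, LinearMap.mulRight_apply,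
      LinearMap.mulLeft_apply, mul_add, add_mul]
    abel
  map_smul' c u := by
    refine LinearMap.ext fun T => ?_
    simp only [map_smul, LinearMap.sub_apply, LinearMap.smul_apply, LinearMap.mulRight_apply,
      LinearMap.mulLeft_apply, mul_smul_comm, smul_mul_assoc, smul_sub, RingHom.id_apply]

theorem ad_apply (u : A) (T : Module.End K Γ) :
    ad K Γ u T = T * γ K A Γ u - γ K A Γ u * T := rfl

theorem iterBracket_eq (u : A) (k : ℕ) (T : Module.End K Γ) :
    iterBracket u k T = (ad K Γ u ^ k) T := by
  rw [Module.End.pow_apply]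
  rfl

theorem ad_γ (u v : A) : ad K Γ u (γ K A Γ v) = 0 := by
  rw [ad_apply, γ_comm, sub_self]

theorem ad_mul (u : A) (S T : Module.End K Γ) :
    ad K Γ u (S * T) = S * ad K Γ u T + ad K Γ u S * T := by
  simp only [ad_apply]
  noncomm_ring

theorem ad_commute (u v : A) : Commute (ad K Γ u) (ad K Γ v) := by
  refine LinearMap.ext fun T => ?_
  simp only [Module.End.mul_apply, ad_apply, mul_sub, sub_mul, mul_assoc, γ_comm u v]
  rw [← mul_assoc (γ K A Γ v) (γ K A Γ u) T, ← mul_assoc (γ K A Γ u) (γ K A Γ v) T, γ_comm u v]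
  abel

theorem ad_mul_arg (u v : A) (T : Module.End K Γ) :
    ad K Γ (u * v) T = ad K Γ u T * γ K A Γ v + γ K A Γ u * ad K Γ v T := by
  simp only [ad_apply, map_mul]
  noncomm_ring

theorem ad_mul_γ (u v : A) (T : Module.End K Γ) :
    ad K Γ u (T * γ K A Γ v) = ad K Γ u T * γ K A Γ v := by
  rw [ad_mul, ad_γ, mul_zero, zero_add]

theorem ad_γ_mul (u v : A) (T : Module.End K Γ) :
    ad K Γ u (γ K A Γ v * T) = γ K A Γ v * ad K Γ u T := by
  rw [ad_mul, ad_γ, zero_mul, add_zero]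

theorem ad_pow_mul_γ (u v : A) (k : ℕ) (T : Module.End K Γ) :
    (ad K Γ u ^ k) (T * γ K A Γ v) = (ad K Γ u ^ k) T * γ K A Γ v := by
  induction k generalizing T with
  | zero => rfl
  | succ k ih => rw [pow_succ, Module.End.mul_apply, Module.End.mul_apply, ad_mul_γ, ih]

theorem ad_pow_γ_mul (u v : A) (k : ℕ) (T : Module.End K Γ) :
    (ad K Γ u ^ k) (γ K A Γ v * T) = γ K A Γ v * (ad K Γ u ^ k) T := by
  induction k generalizing T with
  | zero => rfl
  | succ k ih => rw [pow_succ, Module.End.mul_apply, Module.End.mul_apply, ad_γ_mul, ih]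

variable (A) in
/-- The operators all of whose `k`-fold commutators with multiplication operators lie in `B`. -/
def commFilt (B : Submodule K (Module.End K Γ)) : ℕ → Submodule K (Module.End K Γ)
  | 0 => B
  | k + 1 => ⨅ u : A, (commFilt B k).comap (ad K Γ u)

theorem mem_commFilt_succ {B : Submodule K (Module.End K Γ)} {k : ℕ} {T : Module.End K Γ} :
    T ∈ commFilt A B (k + 1) ↔ ∀ u : A, ad K Γ u T ∈ commFilt A B k := by
  simp [commFilt]

theorem commFilt_mono {B C : Submodule K (Module.End K Γ)} (h : B ≤ C) (k : ℕ) :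
    commFilt A B k ≤ commFilt A C k := by
  induction k with
  | zero => exact h
  | succ k ih => exact iInf_mono fun u => Submodule.comap_mono ih

theorem commFilt_succ_eq (B : Submodule K (Module.End K Γ)) (k : ℕ) :
    commFilt A B (k + 1) = commFilt A (commFilt A B 1) k := by
  induction k with
  | zero => rfl
  | succ k ih =>
    ext T
    rw [mem_commFilt_succ, ih, mem_commFilt_succ]

theorem commFilt_inf (B C : Submodule K (Module.End K Γ)) (k : ℕ) :
    commFilt A (B ⊓ C) k = commFilt A B k ⊓ commFilt A C k := by
  induction k with
  | zero => rfl
  | succ k ih =>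
    ext T
    simp only [mem_commFilt_succ, ih, Submodule.mem_inf, forall_and]

theorem diffOp_eq_commFilt (k : ℕ) : diffOp K A Γ k = commFilt A (diffOp K A Γ 0) k := by
  induction k with
  | zero => rfl
  | succ k ih =>
    ext T
    rw [mem_commFilt_succ, mem_diffOp_succ, ih]
    rfl

variable (K A Γ) in
/-- The differential operators of order less than `k` in the usual sense: those annihilated by all
`k`-fold commutators with multiplication operators. Since `P^(k-1)` is defined by commutators ending
in multiplication operators rather than in arbitrary bundle endomorphisms,
`P^(k-1) ⊆ orderLT k ⊆ P^k`. -/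
def orderLT (k : ℕ) : Submodule K (Module.End K Γ) := commFilt A ⊥ k

theorem mem_orderLT_one {T : Module.End K Γ} :
    T ∈ orderLT K A Γ 1 ↔ ∀ u : A, ad K Γ u T = 0 := mem_commFilt_succ

theorem orderLT_le_diffOp (k : ℕ) : orderLT K A Γ k ≤ diffOp K A Γ k := by
  rw [diffOp_eq_commFilt]
  exact commFilt_mono bot_le k

/-- Operators of order at most `k` are those whose `k`-fold commutators are bundle endomorphisms. -/
theorem orderLT_succ_eq (k : ℕ) :
    orderLT K A Γ (k + 1) = commFilt A (orderLT K A Γ 1) k := commFilt_succ_eq ⊥ k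

theorem diffOpBelow_le_orderLT (k : ℕ) : diffOpBelow K A Γ k ≤ orderLT K A Γ k := by
  cases k with
  | zero => exact le_rfl
  | succ k =>
    change diffOp K A Γ k ≤ _
    rw [diffOp_eq_commFilt, orderLT_succ_eq]
    refine commFilt_mono ?_ k
    rintro _ ⟨v, rfl⟩
    exact mem_orderLT_one.2 fun u => ad_γ u v

theorem mul_mem_orderLT {i j : ℕ} {S T : Module.End K Γ} (hS : S ∈ orderLT K A Γ (i + 1))
    (hT : T ∈ orderLT K A Γ (j + 1)) : S * T ∈ orderLT K A Γ (i + j + 1) := by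
  suffices H : ∀ n i j : ℕ, i + j = n → ∀ S T : Module.End K Γ, S ∈ orderLT K A Γ (i + 1) →
      T ∈ orderLT K A Γ (j + 1) → S * T ∈ orderLT K A Γ (n + 1) from H _ i j rfl S T hS hT
  clear hS hT S T i j
  intro n
  induction n with
  | zero =>
    intro i j hij S T hS hT
    obtain ⟨rfl, rfl⟩ : i = 0 ∧ j = 0 := by omega
    refine mem_orderLT_one.2 fun u => ?_
    rw [ad_mul, mem_orderLT_one.1 hS, mem_orderLT_one.1 hT, mul_zero, zero_mul, add_zero]
  | succ n ih =>
    intro i j hij S T hS hT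
    refine mem_commFilt_succ.2 fun u => ?_
    have h1 := mem_commFilt_succ.1 hS u
    have h2 := mem_commFilt_succ.1 hT u
    rw [ad_mul]
    refine Submodule.add_mem _ ?_ ?_
    · cases j with
      | zero => rw [show _ = (0 : Module.End K Γ) from h2, mul_zero]; exact Submodule.zero_mem _
      | succ j => exact ih i j (by omega) _ _ hS h2
    · cases i with
      | zero => rw [show _ = (0 : Module.End K Γ) from h1, zero_mul]; exact Submodule.zero_mem _
      | succ i => exact ih i j (by omega) _ _ h1 hT

/-- Operators of order `< i` and `< j` compose to one of order `< i + j - 1`, hence in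
`P^(i+j-1)`. This is why the kernel of the principal symbol map squares to zero. -/
theorem mul_mem_diffOpBelow_of_orderLT {i j : ℕ} {S T : Module.End K Γ}
    (hS : S ∈ orderLT K A Γ i) (hT : T ∈ orderLT K A Γ j) :
    S * T ∈ diffOpBelow K A Γ (i + j) := by
  cases i with
  | zero => rw [show S = 0 from hS, zero_mul]; exact Submodule.zero_mem _
  | succ i =>
    cases j with
    | zero => rw [show T = 0 from hT, mul_zero]; exact Submodule.zero_mem _
    | succ j =>
      rw [show i + 1 + (j + 1) = (i + j + 1) + 1 by omega]
      exact orderLT_le_diffOp _ (mul_mem_orderLT hS hT)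

theorem ad_mem_diffOp {k : ℕ} {T : Module.End K Γ} (hT : T ∈ diffOp K A Γ (k + 1)) (u : A) :
    ad K Γ u T ∈ diffOp K A Γ k := hT u

theorem ad_pow_mem_diffOp (u : A) (k : ℕ) {T : Module.End K Γ} (hT : T ∈ diffOp K A Γ k) :
    (ad K Γ u ^ k) T ∈ diffOp K A Γ 0 := by
  induction k generalizing T with
  | zero => exact hT
  | succ k ih =>
    rw [pow_succ, Module.End.mul_apply]
    exact ih (hT u)

theorem ad_pow_eq_zero (u : A) (k : ℕ) {T : Module.End K Γ} (hT : T ∈ orderLT K A Γ k) :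
    (ad K Γ u ^ k) T = 0 := by
  induction k generalizing T with
  | zero => exact hT
  | succ k ih =>
    rw [pow_succ, Module.End.mul_apply]
    exact ih (mem_commFilt_succ.1 hT u)

/-- The top-degree Leibniz rule: on `P^i × P^j`, only one term of the Leibniz expansion of an
`(i+j)`-fold commutator survives. -/
theorem ad_pow_mul (u : A) {i j : ℕ} {S T : Module.End K Γ} (hS : S ∈ diffOp K A Γ i)
    (hT : T ∈ diffOp K A Γ j) :
    (ad K Γ u ^ (i + j)) (S * T)
      = (i + j).choose i • ((ad K Γ u ^ i) S * (ad K Γ u ^ j) T) := by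
  suffices H : ∀ n i j : ℕ, i + j = n → ∀ S T : Module.End K Γ, S ∈ diffOp K A Γ i →
      T ∈ diffOp K A Γ j → (ad K Γ u ^ n) (S * T)
      = n.choose i • ((ad K Γ u ^ i) S * (ad K Γ u ^ j) T) from H _ i j rfl S T hS hT
  clear hS hT S T i j
  intro n
  induction n with
  | zero =>
    intro i j hij S T hS hT
    obtain ⟨rfl, rfl⟩ : i = 0 ∧ j = 0 := by omega
    simp
  | succ n ih =>
    intro i j hij S T hS hT
    cases i with
    | zero =>
      obtain ⟨v, rfl⟩ := hS
      obtain rfl : j = n + 1 := by omega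
      simp [ad_pow_γ_mul]
    | succ i =>
      cases j with
      | zero =>
        obtain ⟨v, rfl⟩ := hT
        obtain rfl : i = n := by omega
        simp [ad_pow_mul_γ]
      | succ j =>
        rw [pow_succ, Module.End.mul_apply, ad_mul, map_add,
          ih (i + 1) j (by omega) _ _ hS (ad_mem_diffOp hT u),
          ih i (j + 1) (by omega) _ _ (ad_mem_diffOp hS u) hT,
          Nat.choose_succ_succ, add_smul, add_comm]
        simp only [pow_succ (ad K Γ u) i, pow_succ (ad K Γ u) j, Module.End.mul_apply]

/-! ### The filtration attached to a connection -/

/-- The operators whose iterated commutators end, one step before order zero, in the space `H` of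
first-order operators. -/
def splitOp (H : Submodule K (Module.End K Γ)) : ℕ → Submodule K (Module.End K Γ)
  | 0 => diffOp K A Γ 0
  | k + 1 => commFilt A H k

/-- `H` is a space of first-order operators with scalar symbol which contains the multiplication
operators, is stable under multiplication by functions, and contains no bundle endomorphism other
than the multiplication operators. The example in mind consists of the operators `∇_D + γ w` of a
connection `∇`. -/
structure IsHorizontal (H : Submodule K (Module.End K Γ)) : Prop where
  diffOp_zero_le : diffOp K A Γ 0 ≤ H
  le_diffOp_one : H ≤ diffOp K A Γ 1
  γ_mul_mem : ∀ (u : A) {T}, T ∈ H → γ K A Γ u * T ∈ H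
  inf_le : H ⊓ orderLT K A Γ 1 ≤ diffOp K A Γ 0

namespace IsHorizontal

variable {H : Submodule K (Module.End K Γ)} (hH : IsHorizontal (A := A) H)
include hH

theorem splitOp_le_diffOp (k : ℕ) : splitOp (A := A) H k ≤ diffOp K A Γ k := by
  cases k with
  | zero => exact le_rfl
  | succ k =>
    rw [diffOp_eq_commFilt (k + 1), commFilt_succ_eq, ← diffOp_eq_commFilt]
    exact commFilt_mono hH.le_diffOp_one k

theorem ad_mem_splitOp {k : ℕ} {T : Module.End K Γ} (hT : T ∈ splitOp (A := A) H (k + 1)) (u : A) :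
    ad K Γ u T ∈ splitOp (A := A) H k := by
  cases k with
  | zero => exact hH.le_diffOp_one hT u
  | succ k => exact mem_commFilt_succ.1 hT u

/-- The Leibniz rule reduces products to those involving a factor in `P^0`; a right factor `γ v` is
moved to the left at the cost of the commutator `ad v S`, which is a multiplication operator. -/
theorem mul_mem_splitOp {i j : ℕ} {S T : Module.End K Γ} (hS : S ∈ splitOp (A := A) H i)
    (hT : T ∈ splitOp (A := A) H j) : S * T ∈ splitOp (A := A) H (i + j) := by
  suffices h : ∀ n i j : ℕ, i + j = n → ∀ S T : Module.End K Γ, S ∈ splitOp (A := A) H i →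
      T ∈ splitOp (A := A) H j → S * T ∈ splitOp (A := A) H n from h _ i j rfl S T hS hT
  clear hS hT S T i j
  have h0 : ∀ {j : ℕ} {S T : Module.End K Γ} (u : A), S ∈ diffOp K A Γ 0 → ad K Γ u S = 0 := by
    rintro - _ - u ⟨v, rfl⟩
    exact ad_γ u v
  intro n
  induction n with
  | zero =>
    intro i j hij S T hS hT
    obtain ⟨rfl, rfl⟩ : i = 0 ∧ j = 0 := by omega
    exact mul_mem_diffOp (i := 0) (j := 0) hS hT
  | succ n ih =>
    intro i j hij S T hS hT
    cases n with
    | zero =>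
      rcases (by omega : (i = 0 ∧ j = 1) ∨ (i = 1 ∧ j = 0)) with ⟨rfl, rfl⟩ | ⟨rfl, rfl⟩
      · obtain ⟨v, rfl⟩ := hS
        exact hH.γ_mul_mem v hT
      · obtain ⟨v, rfl⟩ := hT
        change S * γ K A Γ v ∈ H
        rw [show S * γ K A Γ v = ad K Γ v S + γ K A Γ v * S by rw [ad_apply]; abel]
        exact H.add_mem (hH.diffOp_zero_le (hH.le_diffOp_one hS v)) (hH.γ_mul_mem v hS)
    | succ n =>
      refine mem_commFilt_succ.2 fun u => ?_
      rw [ad_mul]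
      refine Submodule.add_mem _ ?_ ?_
      · cases j with
        | zero =>
          obtain ⟨v, rfl⟩ := hT
          change S * ad K Γ u (γ K A Γ v) ∈ _
          rw [ad_γ, mul_zero]; exact Submodule.zero_mem _
        | succ j => exact ih i j (by omega) _ _ hS (hH.ad_mem_splitOp hT u)
      · cases i with
        | zero =>
          obtain ⟨v, rfl⟩ := hS
          change ad K Γ u (γ K A Γ v) * T ∈ _
          rw [ad_γ, zero_mul]; exact Submodule.zero_mem _
        | succ i => exact ih i j (by omega) _ _ (hH.ad_mem_splitOp hS u) hT

/-- An operator of `splitOp H k` with vanishing principal symbol of order `k` lies in `P^(k-1)`. -/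
theorem mem_diffOpBelow {k : ℕ} {T : Module.End K Γ} (hT : T ∈ splitOp (A := A) H k)
    (hT' : T ∈ orderLT K A Γ k) : T ∈ diffOpBelow K A Γ k := by
  cases k with
  | zero => exact hT'
  | succ k =>
    change T ∈ diffOp K A Γ k
    rw [diffOp_eq_commFilt]
    refine commFilt_mono hH.inf_le k ?_
    rw [commFilt_inf, ← orderLT_succ_eq]
    exact ⟨hT, hT'⟩

end IsHorizontal

end Filtrations

/-! ### Polarization -/

/-- Interpolation weights at `0, …, n` computing the derivative at `0` of any polynomial of degree
at most `n`. -/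
theorem exists_derivWeights (n : ℕ) : ∃ c : ℕ → ℝ, ∀ i ≤ n,
    ∑ j ∈ Finset.range (n + 1), c j * (j : ℝ) ^ i = if i = 1 then 1 else 0 := by
  have hinj : Set.InjOn (fun j : ℕ => (j : ℝ)) (Finset.range (n + 1)) :=
    fun a _ b _ h => Nat.cast_injective h
  refine ⟨fun j => (Lagrange.basis (Finset.range (n + 1)) (fun j : ℕ => (j : ℝ)) j).derivative.eval
    0, fun i hi => ?_⟩
  have h := Lagrange.eq_interpolate (f := (Polynomial.X ^ i : Polynomial ℝ)) hinj (by
    rw [Polynomial.degree_X_pow, Finset.card_range]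
    exact_mod_cast Nat.lt_succ_of_le hi)
  have h2 := congrArg (fun q => (Polynomial.derivative q).eval 0) h
  simp only [Lagrange.interpolate_apply, Polynomial.derivative_sum, Polynomial.eval_finsetSum,
    Polynomial.derivative_C_mul, Polynomial.eval_C_mul, Polynomial.eval_pow,
    Polynomial.eval_X] at h2
  simp_rw [mul_comm _ (((_ : ℕ) : ℝ) ^ i)]
  rw [← h2, Polynomial.derivative_X_pow]
  rcases i with _ | _ | i <;> simp

section Real

variable {A Γ : Type*} [CommRing A] [Algebra ℝ A] [AddCommGroup Γ] [Module ℝ Γ]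
  [Module A Γ] [IsScalarTower ℝ A Γ]

/-- Polarization: an operator is annihilated by all `k`-fold commutators as soon as it is
annihilated by those with one repeated argument. -/
theorem mem_orderLT_of_ad_pow_eq_zero {k : ℕ} {T : Module.End ℝ Γ}
    (h : ∀ u : A, (ad ℝ Γ u ^ k) T = 0) : T ∈ orderLT ℝ A Γ k := by
  induction k generalizing T with
  | zero => exact h 0
  | succ k ih =>
    refine mem_commFilt_succ.2 fun v => ih fun u => ?_
    obtain ⟨c, hc⟩ := exists_derivWeights (k + 1)
    -- expand the commutator power along the line `u + j v` and extract the coefficient linear in `j`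
    have h1 : ∀ j : ℕ, ∑ i ∈ Finset.range (k + 1 + 1),
        (j : ℝ) ^ i • ((k + 1).choose i : ℝ) • (ad ℝ Γ u ^ (k + 1 - i)) ((ad ℝ Γ v ^ i) T) = 0 := by
      intro j
      have h2 := h ((j : ℝ) • v + u)
      rw [map_add, map_smul, (((ad_commute v u).smul_left (j : ℝ))).add_pow] at h2
      rw [LinearMap.sum_apply] at h2
      rw [← h2]
      refine Finset.sum_congr rfl fun i hi => ?_
      rw [smul_pow, ((ad_commute v u).pow_pow i (k + 1 - i)).smul_left ((j : ℝ) ^ i) |>.eq,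
        ← nsmul_eq_mul', LinearMap.smul_apply, Module.End.mul_apply, LinearMap.smul_apply, map_smul,
        ← Nat.cast_smul_eq_nsmul ℝ, smul_comm]
    have h3 : ∑ j ∈ Finset.range (k + 1 + 1), c j • ∑ i ∈ Finset.range (k + 1 + 1),
        (j : ℝ) ^ i • ((k + 1).choose i : ℝ) • (ad ℝ Γ u ^ (k + 1 - i)) ((ad ℝ Γ v ^ i) T) = 0 :=
      Finset.sum_eq_zero fun j _ => by rw [h1, smul_zero]
    simp_rw [Finset.smul_sum, smul_smul _ (_ ^ _)] at h3
    rw [Finset.sum_comm] at h3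
    simp_rw [← Finset.sum_smul] at h3
    rw [Finset.sum_congr rfl fun i hi => by
      rw [hc i (Nat.lt_succ_iff.1 (Finset.mem_range.1 hi))]] at h3
    simp only [ite_smul, one_smul, zero_smul, Finset.sum_ite_eq', Finset.mem_range] at h3
    rw [if_pos (by omega), Nat.choose_one_right, pow_one, Nat.add_sub_cancel] at h3
    exact (smul_eq_zero.1 h3).resolve_left (by positivity)

end Real

/-! ### Hadamard's lemma -/

section Calculus

theorem contDiff_parametric_integral {E F : Type} [NormedAddCommGroup E] [NormedSpace ℝ E]
    [ProperSpace E] [NormedAddCommGroup F] [NormedSpace ℝ F] {f : E → ℝ → F} (n : ℕ)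
    (hf : ContDiff ℝ n (Function.uncurry f)) : ContDiff ℝ n fun x => ∫ t in (0 : ℝ)..1, f x t := by
  induction n generalizing F with
  | zero =>
    rw [Nat.cast_zero, contDiff_zero] at *
    exact intervalIntegral.continuous_parametric_intervalIntegral_of_continuous' hf 0 1
  | succ n ih =>
    have hd : ∀ x t, HasFDerivAt (fun y => f y t)
        ((fderiv ℝ (Function.uncurry f) (x, t)).comp (ContinuousLinearMap.inl ℝ E ℝ)) x := by
      intro x t
      have h1 : HasFDerivAt (Function.uncurry f) (fderiv ℝ (Function.uncurry f) (x, t)) (x, t) :=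
        ((hf.differentiable (by simp)) (x, t)).hasFDerivAt
      exact HasFDerivAt.comp (f := fun e => (e, t)) x h1 (hasFDerivAt_prodMk_left x t)
    set f' : E → ℝ → (E →L[ℝ] F) := fun x t =>
      (fderiv ℝ (Function.uncurry f) (x, t)).comp (ContinuousLinearMap.inl ℝ E ℝ) with hf'
    have hf'n : ContDiff ℝ n (Function.uncurry f') := by
      have := (hf.fderiv_right (m := n) (by norm_cast))
      exact this.clm_comp contDiff_const
    have hcont : Continuous (Function.uncurry f') := hf'n.continuous
    rw [Nat.cast_succ, contDiff_succ_iff_hasFDerivAt]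
    refine ⟨fun x => ∫ t in (0 : ℝ)..1, f' x t, ih hf'n, fun x₀ => ?_⟩
    obtain ⟨C, hC⟩ := ((isCompact_closedBall x₀ 1).prod (isCompact_Icc (a := (0 : ℝ)) (b := 1))
      ).exists_bound_of_continuousOn hcont.continuousOn
    have hcx : ∀ x, Continuous (f x) := fun x =>
      hf.continuous.comp (Continuous.prodMk_right x)
    have hcx' : ∀ x, Continuous (f' x) := fun x => hcont.comp (Continuous.prodMk_right x)
    refine (intervalIntegral.hasFDerivAt_integral_of_dominated_of_fderiv_le (bound := fun _ => C)
      (Metric.ball_mem_nhds x₀ one_pos) (Filter.Eventually.of_forall fun x =>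
        (hcx x).aestronglyMeasurable) ((hcx x₀).intervalIntegrable _ _)
      (hcx' x₀).aestronglyMeasurable ?_ (by simp) ?_)
    · refine Filter.Eventually.of_forall fun t ht x hx =>
        hC (x, t) ⟨Metric.ball_subset_closedBall hx, ?_⟩
      rw [Set.uIoc_of_le zero_le_one] at ht
      exact ⟨ht.1.le, ht.2⟩
    · exact Filter.Eventually.of_forall fun t _ x _ => hd x t

/-- Hadamard's lemma, with the value at `y₀` of the factors: integrate the derivative of `f` along
the segments from `y₀`. -/
theorem exists_hadamard {m : ℕ} {f : EuclideanSpace ℝ (Fin m) → ℝ} (hf : ContDiff ℝ ∞ f)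
    (y₀ : EuclideanSpace ℝ (Fin m)) : ∃ g : Fin m → EuclideanSpace ℝ (Fin m) → ℝ,
      (∀ i, ContDiff ℝ ∞ (g i)) ∧ (∀ y, f y = f y₀ + ∑ i, (y i - y₀ i) * g i y) ∧
      ∀ i, g i y₀ = fderiv ℝ f y₀ (EuclideanSpace.single i 1) := by
  set h : Fin m → EuclideanSpace ℝ (Fin m) → ℝ → ℝ := fun i y t =>
    fderiv ℝ f (y₀ + t • (y - y₀)) (EuclideanSpace.single i 1)
  have hh : ∀ i, ContDiff ℝ ∞ (Function.uncurry (h i)) := by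
    intro i
    have h1 : ContDiff ℝ ∞ (fderiv ℝ f) := hf.fderiv_right (by simp)
    exact (h1.comp (by fun_prop : ContDiff ℝ ∞ fun p : EuclideanSpace ℝ (Fin m) × ℝ =>
      y₀ + p.2 • (p.1 - y₀))).clm_apply contDiff_const
  refine ⟨fun i y => ∫ t in (0 : ℝ)..1, h i y t, fun i => contDiff_infty.2 fun n =>
    contDiff_parametric_integral n ((hh i).of_le (by exact_mod_cast le_top)),
    fun y => ?_, fun i => ?_⟩
  · have hder : ∀ t : ℝ, HasDerivAt (fun t : ℝ => f (y₀ + t • (y - y₀)))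
        (fderiv ℝ f (y₀ + t • (y - y₀)) (y - y₀)) t := by
      intro t
      have h1 := ((hf.differentiable (by simp)) (y₀ + t • (y - y₀))).hasFDerivAt
      have h2 : HasDerivAt (fun t : ℝ => y₀ + t • (y - y₀)) (y - y₀) t := by
        simpa using ((hasDerivAt_id t).smul_const (y - y₀)).const_add y₀
      exact h1.comp_hasDerivAt t h2
    have hexp : ∀ t : ℝ, fderiv ℝ f (y₀ + t • (y - y₀)) (y - y₀)
        = ∑ i, (y i - y₀ i) * h i y t := by
      intro t
      have hL : ∀ (L : EuclideanSpace ℝ (Fin m) →L[ℝ] ℝ) (v : EuclideanSpace ℝ (Fin m)),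
          L v = ∑ i, v i * L (EuclideanSpace.single i 1) := by
        intro L v
        conv_lhs => rw [← (EuclideanSpace.basisFun (Fin m) ℝ).sum_repr v]
        simp
      rw [hL]
      simp [h]
    have hc : ∀ i, Continuous (h i y) := fun i => (hh i).continuous.comp (Continuous.prodMk_right y)
    have hint := intervalIntegral.integral_eq_sub_of_hasDerivAt (a := 0) (b := 1)
      (fun t _ => hder t) (by
        simp_rw [hexp]
        exact (continuous_finsetSum _ fun i _ => (hc i).const_mul _).intervalIntegrable _ _)
    simp_rw [hexp] at hint
    rw [intervalIntegral.integral_finsetSum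
      (fun i _ => ((hc i).const_mul _).intervalIntegrable _ _)] at hint
    simp_rw [intervalIntegral.integral_const_mul] at hint
    rw [hint]
    simp
  · simp [h]

end Calculus

/-! ### Differentials and local coframes -/

section Geometry

variable {m : ℕ} {M : Type*} [TopologicalSpace M] [ChartedSpace (EuclideanSpace ℝ (Fin m)) M]
  [IsManifold (𝓡 m) ∞ M]

theorem contMDiff_differential (u : SmoothFun m M) :
    ContMDiff (𝓡 m) ((𝓡 m).prod 𝓘(ℝ, EuclideanSpace ℝ (Fin m) →L[ℝ] ℝ)) ∞
      (fun x => (⟨x, mvfderiv (𝓡 m) u x⟩ : CotangentBundle m M)) := by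
  intro x₀
  rw [contMDiffAt_totalSpace]
  refine ⟨contMDiffAt_id, ?_⟩
  have h := ContMDiffAt.mfderiv_const (n := ∞) (m := ∞) (u.contMDiff x₀) (by simp)
  refine h.congr_of_eventuallyEq ?_
  have hx : x₀ ∈ (trivializationAt (EuclideanSpace ℝ (Fin m))
      (TangentSpace (𝓡 m) : M → Type _) x₀).baseSet := mem_baseSet_trivializationAt _ _ x₀
  filter_upwards [(trivializationAt (EuclideanSpace ℝ (Fin m))
    (TangentSpace (𝓡 m) : M → Type _) x₀).open_baseSet.mem_nhds hx] with x hx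
  simp only [hom_trivializationAt_apply, inTangentCoordinates, ContinuousLinearMap.inCoordinates]
  rw [TangentBundle.continuousLinearMapAt_model_space]
  ext w
  simp [mvfderiv]
  rfl

/-- The pairing of covectors with a smooth vector field is smooth on `T*M`. -/
theorem contMDiffAt_cotangent_apply (v : ∀ x : M, TangentSpace (𝓡 m) x) (x₀ : CotangentBundle m M)
    (hv : ContMDiffAt (𝓡 m) ((𝓡 m).prod (𝓡 m)) ∞
      (fun x => (⟨x, v x⟩ : TangentBundle (𝓡 m) M)) x₀.1) :
    ContMDiffAt ((𝓡 m).prod 𝓘(ℝ, EuclideanSpace ℝ (Fin m) →L[ℝ] ℝ)) 𝓘(ℝ, ℝ) ∞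
      (fun p : CotangentBundle m M => p.2 (v p.1)) x₀ := by
  have h := ContMDiffAt.clm_bundle_apply (E₁ := (TangentSpace (𝓡 m) : M → Type _))
    (E₂ := Bundle.Trivial M ℝ) (F₁ := EuclideanSpace ℝ (Fin m)) (F₂ := ℝ) (IB := 𝓡 m) (n := ∞)
    (b := fun p : CotangentBundle m M => p.1) (ϕ := fun p => p.2) (v := fun p => v p.1)
    (IM := (𝓡 m).prod 𝓘(ℝ, EuclideanSpace ℝ (Fin m) →L[ℝ] ℝ)) (x := x₀) contMDiffAt_id ?_
  · rw [contMDiffAt_totalSpace] at h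
    exact h.2
  · exact hv.comp x₀ (contMDiffAt_proj _)

/-- Evaluation of smooth functions at a point. -/
def evalAt (x : M) : SmoothFun m M →ₗ[ℝ] ℝ where
  toFun f := f x
  map_add' _ _ := rfl
  map_smul' _ _ := rfl

omit [IsManifold (𝓡 m) ∞ M] in
theorem evalAt_apply (x : M) (f : SmoothFun m M) : evalAt x f = f x := rfl

/-- The value at `x` of a fibrewise function along the differential of `u`: the smooth function
`x ↦ p (x, d_x u)`. -/
def evalDiff (p : CotangentFun m M) (u : SmoothFun m M) : SmoothFun m M :=
  p.comp ⟨_, contMDiff_differential u⟩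

/-- The fibrewise linear function on `T*M` given by a smooth vector field. -/
def ofVectorField (v : ∀ x : M, TangentSpace (𝓡 m) x)
    (hv : ContMDiff (𝓡 m) ((𝓡 m).prod (𝓡 m)) ∞ (fun x => (⟨x, v x⟩ : TangentBundle (𝓡 m) M))) :
    Pol m M 1 :=
  ⟨⟨fun p => p.2 (v p.1), fun p => contMDiffAt_cotangent_apply v p (hv p.1)⟩, fun x =>
    ⟨(MultilinearMap.mkPiAlgebra ℝ (Fin 1) ℝ).compLinearMap fun _ =>
      { toFun := fun ξ : TangentSpace (𝓡 m) x →L[ℝ] ℝ => ξ (v x)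
        map_add' := fun _ _ => rfl
        map_smul' := fun _ _ => rfl }, fun ξ => by simp; rfl⟩⟩

omit [IsManifold (𝓡 m) ∞ M] in
theorem mdiffAt_smoothFun (u : SmoothFun m M) (x : M) : MDifferentiableAt (𝓡 m) 𝓘(ℝ, ℝ) u x :=
  u.contMDiff.mdifferentiable (by simp) x

variable [T2Space M]

/-- Near each point there are globally defined functions `u i` and vector fields `X i` such that
`ξ = ∑ i, ξ (X i) • d (u i)` for all covectors: cut off the coordinates of a chart and the
corresponding frame. -/
theorem exists_local_coframe (x₀ : M) : ∃ (u : Fin m → SmoothFun m M) (X : Fin m → Pol m M 1)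
    (U : Set M), IsOpen U ∧ x₀ ∈ U ∧ ∀ x ∈ U, ∀ ξ : TangentSpace (𝓡 m) x →L[ℝ] ℝ,
      ξ = ∑ i, (X i : CotangentFun m M) ⟨x, ξ⟩ • mvfderiv (𝓡 m) (u i) x := by
  set χ : SmoothBumpFunction (𝓡 m) x₀ := Classical.choice inferInstance
  set e := trivializationAt (EuclideanSpace ℝ (Fin m)) (TangentSpace (𝓡 m) : M → Type _) x₀
  set b := (EuclideanSpace.basisFun (Fin m) ℝ).toBasis
  have hbase : e.baseSet = (chartAt (EuclideanSpace ℝ (Fin m)) x₀).source := rfl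
  have hφ : ContMDiffOn (𝓡 m) 𝓘(ℝ, EuclideanSpace ℝ (Fin m)) ∞ (extChartAt (𝓡 m) x₀)
      (chartAt (EuclideanSpace ℝ (Fin m)) x₀).source := contMDiffOn_extChartAt
  have hφi : ∀ i, ContMDiffOn (𝓡 m) 𝓘(ℝ, ℝ) ∞ (fun x => extChartAt (𝓡 m) x₀ x i)
      (chartAt (EuclideanSpace ℝ (Fin m)) x₀).source := fun i =>
    (EuclideanSpace.proj (𝕜 := ℝ) i).contMDiff.comp_contMDiffOn hφ
  refine ⟨fun i => ⟨_, χ.contMDiff_smul (hφi i)⟩, fun i => ofVectorField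
    ((χ : M → ℝ) • e.localFrame b i)
    (ContMDiffOn.smul_section_of_tsupport (𝕜 := ℝ) (n := ∞) χ.contMDiff.contMDiffOn e.open_baseSet
      (hbase ▸ χ.tsupport_subset_chartAt_source) (e.contMDiffOn_localFrame_baseSet ∞ b i)),
    interior {x | χ x = 1} ∩ e.baseSet, isOpen_interior.inter e.open_baseSet,
    ⟨mem_interior_iff_mem_nhds.2 χ.eventuallyEq_one, mem_baseSet_trivializationAt _ _ x₀⟩, ?_⟩
  rintro x ⟨hx1, hx⟩ ξ
  have hχ : χ x = 1 := (interior_subset hx1 : _)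
  have hdu : ∀ i (w : TangentSpace (𝓡 m) x),
      mvfderiv (𝓡 m) (fun x => χ x • extChartAt (𝓡 m) x₀ x i) x w
      = (e.continuousLinearMapAt ℝ x w) i := by
    intro i w
    have h1 : (fun x => χ x • extChartAt (𝓡 m) x₀ x i) =ᶠ[𝓝 x]
        ((EuclideanSpace.proj (𝕜 := ℝ) i) ∘ (extChartAt (𝓡 m) x₀)) := by
      filter_upwards [mem_interior_iff_mem_nhds.1 hx1] with y hy
      have hy' : χ y = 1 := hy
      simp [hy']
    have h2 : mvfderiv (𝓡 m) (fun x => χ x • extChartAt (𝓡 m) x₀ x i) x =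
       mvfderiv (𝓡 m) ((EuclideanSpace.proj (𝕜 := ℝ) i) ∘ (extChartAt (𝓡 m) x₀)) x := by
      simp only [mvfderiv, h1.mfderiv_eq]
      rfl
    have h3 : e.continuousLinearMapAt ℝ x = mfderiv (𝓡 m) 𝓘(ℝ, EuclideanSpace ℝ (Fin m))
        (extChartAt (𝓡 m) x₀) x :=
      TangentBundle.continuousLinearMapAt_trivializationAt (hbase ▸ hx)
    rw [h2, h3]
    rw [mvfderiv_comp_apply (I' := 𝓘(ℝ, EuclideanSpace ℝ (Fin m))) x
      ((EuclideanSpace.proj (𝕜 := ℝ) i).contMDiff.mdifferentiable (n := 1) (by simp) _)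
      (mdifferentiableAt_extChartAt (hbase ▸ hx))]
    rw [mvfderiv, ContinuousLinearMap.mfderiv_eq]
    rfl
  ext w
  have hw : w = ∑ i, (e.continuousLinearMapAt ℝ x w) i • e.localFrame b i x := by
    conv_lhs => rw [← (e.basisAt b hx).sum_repr w]
    refine Finset.sum_congr rfl fun i _ => ?_
    rw [e.localFrame_apply_of_mem_baseSet b hx]
    congr 1
    simp [Trivialization.basisAt, b, e.coe_linearMapAt_of_mem hx]
  conv_lhs => rw [hw]
  rw [map_sum, sum_apply]
  refine Finset.sum_congr rfl fun i _ => ?_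
  rw [smul_apply]
  erw [hdu i w]
  simp [ofVectorField, hχ, mul_comm]

/-! ### Point derivations -/

omit [T2Space M] in
/-- Hadamard's lemma in a chart: after a cut-off, a function that vanishes to second order at `x₀` is
a sum of products of functions vanishing at `x₀`. -/
theorem exists_hadamard_chart (x₀ : M) (χ : SmoothBumpFunction (𝓡 m) x₀) {f : SmoothFun m M}
    (hf0 : f x₀ = 0) (hf : mvfderiv (𝓡 m) f x₀ = 0) :
    ∃ g : Fin m → EuclideanSpace ℝ (Fin m) → ℝ, (∀ i, ContDiff ℝ ∞ (g i)) ∧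
      (∀ i, g i (extChartAt (𝓡 m) x₀ x₀) = 0) ∧
      ∀ x ∈ (chartAt (EuclideanSpace ℝ (Fin m)) x₀).source, χ x * f x =
        ∑ i, (extChartAt (𝓡 m) x₀ x i - extChartAt (𝓡 m) x₀ x₀ i)
          * g i (extChartAt (𝓡 m) x₀ x) := by
  set φ := extChartAt (𝓡 m) x₀
  have hopen : IsOpen φ.target := isOpen_extChartAt_target x₀
  have hsymm : ∀ y ∈ φ.target, ContDiffAt ℝ ∞ (f ∘ φ.symm) y := by
    intro y hy
    have h1 : ContMDiffOn 𝓘(ℝ, EuclideanSpace ℝ (Fin m)) 𝓘(ℝ, ℝ) ∞ (f ∘ φ.symm) φ.target :=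
      f.contMDiff.comp_contMDiffOn (contMDiffOn_extChartAt_symm x₀)
    exact (h1.contMDiffAt (hopen.mem_nhds hy)).contDiffAt
  set F : EuclideanSpace ℝ (Fin m) → ℝ := fun y => χ.toContDiffBump y * (f ∘ φ.symm) y with hFdef
  have hF : ContDiff ℝ ∞ F := by
    rw [← contMDiff_iff_contDiff]
    refine contMDiff_of_tsupport fun y hy => ?_
    have hy' : y ∈ tsupport χ.toContDiffBump :=
      closure_mono (Function.support_mul_subset_left _ _) hy
    rw [χ.toContDiffBump.tsupport_eq] at hy'
    have hyt : y ∈ φ.target := χ.closedBall_subset ⟨hy', by simp⟩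
    exact (χ.toContDiffBump.contDiffAt.mul (hsymm y hyt)).contMDiffAt
  have hFloc : F =ᶠ[𝓝 (φ x₀)] f ∘ φ.symm := by
    filter_upwards [χ.toContDiffBump.eventuallyEq_one] with y hy
    exact (congrArg (· * (f ∘ φ.symm) y) hy).trans (one_mul _)
  have hF0 : F (φ x₀) = 0 := by
    rw [hFloc.self_of_nhds, Function.comp_apply, extChartAt_to_inv, hf0]
  have hFd : fderiv ℝ F (φ x₀) = 0 := by
    rw [hFloc.fderiv_eq]
    have h1 := (mdiffAt_smoothFun f x₀).mvfderiv
    rw [hf] at h1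
    simp only [modelWithCornersSelf_coe, Set.range_id, fderivWithin_univ] at h1
    exact h1.symm
  obtain ⟨g, hg, hg', hg0⟩ := exists_hadamard hF (φ x₀)
  refine ⟨g, hg, fun i => by rw [hg0, hFd]; rfl, fun x hx => ?_⟩
  have hx' : x ∈ φ.source := by rwa [extChartAt_source]
  have h2 := hg' (φ x)
  rw [hF0, zero_add] at h2
  rw [← h2, χ.eqOn_source hx]
  simp only [hFdef, Function.comp_apply]
  rw [φ.left_inv hx']

/-- A point derivation of the algebra of smooth functions factors through the differential. -/
theorem pointDerivation_eq_zero (x₀ : M) (ℓ : SmoothFun m M →ₗ[ℝ] ℝ)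
    (hℓ : ∀ f g, ℓ (f * g) = f x₀ * ℓ g + g x₀ * ℓ f) {f : SmoothFun m M}
    (hf : mvfderiv (𝓡 m) f x₀ = 0) : ℓ f = 0 := by
  have hone : ℓ 1 = 0 := by
    have h := hℓ 1 1
    simp only [mul_one, ContMDiffMap.coe_one, Pi.one_apply, one_mul] at h
    linarith
  -- subtract the constant `f x₀`
  wlog hf0 : f x₀ = 0 generalizing f
  · have h1 := this (f := f - f x₀ • (1 : SmoothFun m M)) (by
      have h2 : mvfderiv (𝓡 m) (⇑f - fun _ => f x₀) x₀ = 0 := by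
        rw [mvfderiv_sub (mdiffAt_smoothFun f x₀) mdifferentiableAt_const, hf]
        simp [mvfderiv]
      convert h2 using 2
      ext x
      simp) (by simp)
    rwa [map_sub, map_smul, hone, smul_zero, sub_zero] at h1
  set χ : SmoothBumpFunction (𝓡 m) x₀ := Classical.choice inferInstance
  obtain ⟨g, hg, hg0, hgf⟩ := exists_hadamard_chart x₀ χ hf0 hf
  have hφ : ContMDiffOn (𝓡 m) 𝓘(ℝ, EuclideanSpace ℝ (Fin m)) ∞ (extChartAt (𝓡 m) x₀)
      (chartAt (EuclideanSpace ℝ (Fin m)) x₀).source := contMDiffOn_extChartAt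
  let χ' : SmoothFun m M := ⟨χ, χ.contMDiff⟩
  let a : Fin m → SmoothFun m M := fun i => ⟨_, χ.contMDiff_smul
    (((EuclideanSpace.proj (𝕜 := ℝ) i).contMDiff.comp_contMDiffOn hφ).sub
      (contMDiffOn_const (c := extChartAt (𝓡 m) x₀ x₀ i)))⟩
  let b : Fin m → SmoothFun m M := fun i => ⟨_, χ.contMDiff_smul
    ((hg i).contMDiff.comp_contMDiffOn hφ)⟩
  -- one factor `χ` globalizes the chart expression of `f`, the other two its factors
  have key : (χ' * χ' * χ') * f = ∑ i, a i * b i := by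
    ext x
    rw [show (∑ i, a i * b i) x = ∑ i, a i x * b i x from map_sum (evalAt x) _ _]
    by_cases hx : x ∈ (chartAt (EuclideanSpace ℝ (Fin m)) x₀).source
    · have h := hgf x hx
      calc χ x * χ x * χ x * f x = χ x * χ x * (χ x * f x) := by ring
        _ = _ := by
          rw [h, Finset.mul_sum]
          refine Finset.sum_congr rfl fun i _ => ?_
          change _ = (χ x * _) * (χ x * _)
          simp
          ring
    · have h0 : χ x = 0 := by
        by_contra h
        exact hx (χ.support_subset_source h)
      change χ x * χ x * χ x * f x = ∑ i, (χ x * _) * (χ x * _)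
      simp [h0]
  have hχ1 : (χ' * χ' * χ') x₀ = 1 := by
    change χ x₀ * χ x₀ * χ x₀ = 1
    simp
  have h1 := congrArg ℓ key
  rw [hℓ, hf0, hχ1, map_sum, Finset.sum_eq_zero, one_mul, zero_mul, add_zero] at h1
  · exact h1
  · intro i _
    have ha : a i x₀ = 0 := by
      change χ x₀ * (_ - _) = 0
      simp
    have hb : b i x₀ = 0 := by
      change χ x₀ * g i (extChartAt (𝓡 m) x₀ x₀) = 0
      rw [hg0, mul_zero]
    rw [hℓ, ha, hb, zero_mul, zero_mul, add_zero]

end Geometry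

/-! ### Homogeneous functionals on differentials -/

section Multilinear

variable {N : Type*} [AddCommGroup N] [Module ℝ N]

/-- The derivative of `ξ ↦ b (ξ, …, ξ)` in the direction `η`, computed by interpolation along the
line `ξ + t η`. -/
theorem sum_derivWeights {k : ℕ} (b : MultilinearMap ℝ (fun _ : Fin k => N) ℝ) {c : ℕ → ℝ}
    (hc : ∀ i ≤ k, ∑ j ∈ Finset.range (k + 1), c j * (j : ℝ) ^ i = if i = 1 then 1 else 0)
    (ξ η : N) : ∑ j ∈ Finset.range (k + 1), c j * b (fun _ => ξ + (j : ℝ) • η)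
      = b.linearDeriv (fun _ => ξ) (fun _ => η) := by
  have h1 : ∀ j : ℕ, b (fun _ => ξ + (j : ℝ) • η)
      = ∑ s : Finset (Fin k), (j : ℝ) ^ s.card * b (s.piecewise (fun _ => η) fun _ => ξ) := by
    intro j
    have h := b.map_add_univ (fun _ => (j : ℝ) • η) (fun _ => ξ)
    rw [show (fun _ : Fin k => ξ + (j : ℝ) • η) = (fun _ => (j : ℝ) • η) + fun _ => ξ from
      funext fun _ => add_comm _ _, h]
    refine Finset.sum_congr rfl fun s _ => ?_
    have h2 := b.map_piecewise_smul (fun _ => (j : ℝ)) (s.piecewise (fun _ => η) fun _ => ξ) s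
    rw [Finset.prod_const, smul_eq_mul] at h2
    rw [← h2]
    congr 1
    ext i
    by_cases hi : i ∈ s <;> simp [hi]
  simp_rw [h1, Finset.mul_sum, ← mul_assoc]
  rw [Finset.sum_comm]
  simp_rw [← Finset.sum_mul]
  rw [Finset.sum_congr rfl fun s _ => by
    rw [hc s.card (by simpa using s.card_le_univ)]]
  simp_rw [ite_mul, one_mul, zero_mul]
  rw [← Finset.sum_filter, show (Finset.univ.filter fun s : Finset (Fin k) => s.card = 1)
    = Finset.powersetCard 1 Finset.univ by ext; simp [Finset.mem_powersetCard],
    Finset.powersetCard_one, Finset.sum_map, MultilinearMap.linearDeriv_apply]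
  refine Finset.sum_congr rfl fun i _ => ?_
  simp [Finset.piecewise_singleton]

/-- The directional derivatives of a homogeneous polynomial of degree `k + 1` are homogeneous
polynomials of degree `k`. -/
theorem linearDeriv_const_eq {k : ℕ} (b : MultilinearMap ℝ (fun _ : Fin (k + 1) => N) ℝ)
    (η : N) : ∃ b' : MultilinearMap ℝ (fun _ : Fin k => N) ℝ, ∀ ξ,
      b.linearDeriv (fun _ => ξ) (fun _ => η) = b' fun _ => ξ := by
  refine ⟨∑ i, b.curryMid i η, fun ξ => ?_⟩
  rw [MultilinearMap.linearDeriv_apply, sum_apply]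
  refine Finset.sum_congr rfl fun i _ => ?_
  rw [MultilinearMap.curryMid_apply_apply]
  congr 1
  ext j
  refine Fin.succAboveCases i ?_ (fun j => ?_) j <;> simp

/-- Euler's identity for `ξ ↦ b (ξ, …, ξ)`. -/
theorem sum_smul_linearDeriv {ι : Type*} [Fintype ι] {k : ℕ}
    (b : MultilinearMap ℝ (fun _ : Fin k => N) ℝ) (ξ : N) (a : ι → ℝ) (η : ι → N)
    (hξ : ξ = ∑ i, a i • η i) :
    ∑ i, a i * b.linearDeriv (fun _ => ξ) (fun _ => η i) = k * b fun _ => ξ := by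
  have h : ∑ i, a i * b.linearDeriv (fun _ => ξ) (fun _ => η i)
      = b.linearDeriv (fun _ => ξ) (fun _ => ξ) := by
    conv_rhs => rw [show (fun _ : Fin k => ξ) = ∑ i, a i • (fun _ : Fin k => η i) by
      ext j; simp [Finset.sum_apply]; exact hξ]
    rw [map_sum]
    refine Finset.sum_congr rfl fun i _ => ?_
    rw [map_smul, smul_eq_mul, ← show (fun _ : Fin k => ξ) = ∑ i, a i • (fun _ : Fin k => η i) by
      ext j; simp [Finset.sum_apply]; exact hξ]
  rw [h, MultilinearMap.linearDeriv_apply]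
  simp [Function.update_eq_self]

end Multilinear

section Homogeneous

variable {m : ℕ} {M : Type*} [TopologicalSpace M] [ChartedSpace (EuclideanSpace ℝ (Fin m)) M]

/-- The differential at `x` as a linear map on smooth functions. -/
def diffAt (x : M) : SmoothFun m M →ₗ[ℝ] (TangentSpace (𝓡 m) x →L[ℝ] ℝ) where
  toFun u := mvfderiv (𝓡 m) u x
  map_add' u v := mvfderiv_add (mdiffAt_smoothFun u x) (mdiffAt_smoothFun v x)
  map_smul' r u := by
    have h := mvfderiv_smul (I := 𝓡 m) (a := fun _ : M => r) mdifferentiableAt_const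
      (mdiffAt_smoothFun u x)
    have h0 : mvfderiv (𝓡 m) (fun _ : M => r) x = 0 := by simp [mvfderiv]
    rw [h0] at h
    refine (Eq.trans (congrArg (fun f : M → ℝ => mvfderiv (𝓡 m) f x) ?_) h).trans ?_
    · ext y; simp
    · ext w; simp

theorem diffAt_mul (x : M) (u v : SmoothFun m M) :
    diffAt x (u * v) = u x • diffAt x v + v x • diffAt x u :=
  mvfderiv_mul (mdiffAt_smoothFun u x) (mdiffAt_smoothFun v x)

/-- `p u x` is a homogeneous polynomial of degree `k` in the differential of `u` at `x`. -/
def IsHomogeneousFunctional (k : ℕ) (p : SmoothFun m M → SmoothFun m M) : Prop :=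
  ∀ x : M, ∃ b : MultilinearMap ℝ (fun _ : Fin k => TangentSpace (𝓡 m) x →L[ℝ] ℝ) ℝ,
    ∀ u, p u x = b fun _ => diffAt x u

/-- Every homogeneous functional has directional derivatives along differentials, again
homogeneous functionals; in contrast to derivatives along the fibres of `T*M`, they are smooth by
construction, being linear combinations of values of `p`. -/
theorem IsHomogeneousFunctional.exists_deriv {k : ℕ} {p : SmoothFun m M → SmoothFun m M}
    (hp : IsHomogeneousFunctional (k + 1) p) (v : SmoothFun m M) :
    ∃ q, IsHomogeneousFunctional k q ∧
      ∀ (x : M) (b : MultilinearMap ℝ (fun _ : Fin (k + 1) => TangentSpace (𝓡 m) x →L[ℝ] ℝ) ℝ),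
        (∀ u, p u x = b fun _ => diffAt x u) →
        ∀ u, q u x = b.linearDeriv (fun _ => diffAt x u) (fun _ => diffAt x v) := by
  obtain ⟨c, hc⟩ := exists_derivWeights (k + 1)
  have key : ∀ (x : M)
      (b : MultilinearMap ℝ (fun _ : Fin (k + 1) => TangentSpace (𝓡 m) x →L[ℝ] ℝ) ℝ),
        (∀ u, p u x = b fun _ => diffAt x u) → ∀ u,
        (∑ j ∈ Finset.range (k + 1 + 1), c j • p (u + (j : ℝ) • v)) x
          = b.linearDeriv (fun _ => diffAt x u) (fun _ => diffAt x v) := by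
    intro x b hb u
    rw [← sum_derivWeights b hc, ← evalAt_apply, map_sum]
    refine Finset.sum_congr rfl fun j _ => ?_
    rw [map_smul, evalAt_apply, hb, map_add, map_smul, smul_eq_mul]
  refine ⟨_, fun x => ?_, key⟩
  obtain ⟨b, hb⟩ := hp x
  obtain ⟨b', hb'⟩ := linearDeriv_const_eq b (diffAt x v)
  exact ⟨b', fun u => (key x b hb u).trans (hb' _)⟩

variable [IsManifold (𝓡 m) ∞ M]

theorem isHomogeneousFunctional_evalDiff {k : ℕ} (P : Pol m M k) :
    IsHomogeneousFunctional k (evalDiff (P : CotangentFun m M)) := fun x =>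
  let ⟨b, hb⟩ := P.2 x
  ⟨b, fun _ => hb _⟩

variable [T2Space M]

theorem exists_diffAt_eq (x : M) (ξ : TangentSpace (𝓡 m) x →L[ℝ] ℝ) :
    ∃ u : SmoothFun m M, diffAt x u = ξ := by
  obtain ⟨u, X, U, -, hx, h⟩ := exists_local_coframe (m := m) x
  refine ⟨∑ i, (X i : CotangentFun m M) ⟨x, ξ⟩ • u i, ?_⟩
  rw [map_sum, h x hx ξ]
  refine Finset.sum_congr rfl fun i _ => ?_
  rw [map_smul, ← h x hx ξ]
  rfl

/-- A function on `T*M` is smooth if its composites with differentials of functions form a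
homogeneous functional: near each fibre, Euler's identity expresses it by products of fibrewise
linear functions with the derivatives along a local coframe, which have lower degree. -/
theorem IsHomogeneousFunctional.contMDiff {k : ℕ} {p : SmoothFun m M → SmoothFun m M}
    (hp : IsHomogeneousFunctional k p) {f : CotangentBundle m M → ℝ}
    (hf : ∀ u x, f ⟨x, diffAt x u⟩ = p u x) :
    ContMDiff ((𝓡 m).prod 𝓘(ℝ, EuclideanSpace ℝ (Fin m) →L[ℝ] ℝ)) 𝓘(ℝ, ℝ) ∞ f := by
  induction k generalizing p f with
  | zero =>
    have h : f = p 0 ∘ Bundle.TotalSpace.proj := by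
      ext ⟨x, ξ⟩
      obtain ⟨u, rfl⟩ := exists_diffAt_eq x ξ
      obtain ⟨b, hb⟩ := hp x
      rw [hf, Function.comp_apply, hb, hb]
      exact congrArg b (Subsingleton.elim _ _)
    rw [h]
    exact (p 0).contMDiff.comp (contMDiff_proj _)
  | succ k ih =>
    rintro ⟨x₀, ξ₀⟩
    obtain ⟨u, X, U, hU, hx₀, h⟩ := exists_local_coframe (m := m) x₀
    choose q hq hqp using fun i => hp.exists_deriv (u i)
    choose b hb using fun i x => hq i x
    have hg := fun i => ih (f := fun y => b i y.1 fun _ => y.2) (hq i) fun v x => (hb i x v).symm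
    have hsum : ContMDiff ((𝓡 m).prod 𝓘(ℝ, EuclideanSpace ℝ (Fin m) →L[ℝ] ℝ)) 𝓘(ℝ, ℝ) ∞
        fun y : CotangentBundle m M => ((k + 1 : ℕ) : ℝ)⁻¹ *
          ∑ i, (X i : CotangentFun m M) y * b i y.1 fun _ => y.2 :=
      contMDiff_const.mul (contMDiff_finsetSum fun i _ =>
        (X i : CotangentFun m M).contMDiff.mul (hg i))
    refine (hsum ⟨x₀, ξ₀⟩).congr_of_eventuallyEq ?_
    have hopen : Bundle.TotalSpace.proj ⁻¹' U ∈ 𝓝 (⟨x₀, ξ₀⟩ : CotangentBundle m M) :=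
      (hU.preimage (contMDiff_proj (IB := 𝓡 m) (n := ∞) _).continuous).mem_nhds hx₀
    filter_upwards [hopen]
    rintro ⟨x, ξ⟩ hx
    obtain ⟨v, rfl⟩ := exists_diffAt_eq x ξ
    obtain ⟨B, hB⟩ := hp x
    simp only
    rw [hf, hB, Finset.sum_congr rfl fun i _ => by rw [← hb i x v, hqp i x B hB],
      sum_smul_linearDeriv B (diffAt x v) _ (fun i => diffAt x (u i)) (h x hx _),
      inv_mul_cancel_left₀ (by positivity)]

/-- Homogeneous functionals of degree `k` are the same as elements of `Pol^k(T*M)`. -/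
theorem IsHomogeneousFunctional.exists_pol {k : ℕ} {p : SmoothFun m M → SmoothFun m M}
    (hp : IsHomogeneousFunctional k p) :
    ∃ P : Pol m M k, ∀ u, evalDiff (P : CotangentFun m M) u = p u := by
  choose b hb using hp
  have hp : IsHomogeneousFunctional k p := fun x => ⟨b x, hb x⟩
  refine ⟨⟨⟨fun y => b y.1 fun _ => y.2, hp.contMDiff fun u x => (hb x u).symm⟩,
    fun x => ⟨b x, fun ξ => rfl⟩⟩, fun u => ?_⟩
  ext x
  exact (hb x u).symm

theorem pol_ext {k : ℕ} {P Q : Pol m M k}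
    (h : ∀ u, evalDiff (P : CotangentFun m M) u = evalDiff (Q : CotangentFun m M) u) : P = Q := by
  refine Subtype.ext (ContMDiffMap.ext ?_)
  rintro ⟨x, ξ⟩
  obtain ⟨u, rfl⟩ := exists_diffAt_eq x ξ
  exact congrArg (fun f : SmoothFun m M => f x) (h u)

omit [T2Space M] in
theorem exists_linear_of_pol_one (X : Pol m M 1) (x : M) :
    ∃ L : (TangentSpace (𝓡 m) x →L[ℝ] ℝ) →ₗ[ℝ] ℝ, ∀ ξ, (X : CotangentFun m M) ⟨x, ξ⟩ = L ξ := by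
  obtain ⟨b, hb⟩ := X.2 x
  exact ⟨(MultilinearMap.ofSubsingleton ℝ _ ℝ (0 : Fin 1)).symm b, hb⟩

omit [T2Space M] in
/-- An element of `Pol^1(T*M)` acts on functions as a vector field. -/
def derivationOf (X : Pol m M 1) : Derivation ℝ (SmoothFun m M) (SmoothFun m M) :=
  Derivation.mk'
    { toFun := evalDiff (X : CotangentFun m M)
      map_add' := fun u v => by
        ext x
        obtain ⟨L, hL⟩ := exists_linear_of_pol_one X x
        change (X : CotangentFun m M) ⟨x, diffAt x (u + v)⟩ = (X : CotangentFun m M) ⟨x, diffAt x u⟩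
          + (X : CotangentFun m M) ⟨x, diffAt x v⟩
        rw [hL, hL, hL, map_add, map_add]
      map_smul' := fun r u => by
        ext x
        obtain ⟨L, hL⟩ := exists_linear_of_pol_one X x
        change (X : CotangentFun m M) ⟨x, diffAt x (r • u)⟩
          = r • (X : CotangentFun m M) ⟨x, diffAt x u⟩
        rw [hL, hL, map_smul, map_smul] }
    (fun u v => by
      ext x
      obtain ⟨L, hL⟩ := exists_linear_of_pol_one X x
      change (X : CotangentFun m M) ⟨x, diffAt x (u * v)⟩
        = u x • (X : CotangentFun m M) ⟨x, diffAt x v⟩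
          + v x • (X : CotangentFun m M) ⟨x, diffAt x u⟩
      rw [hL, hL, hL, diffAt_mul, map_add, map_smul, map_smul])

omit [T2Space M] in
theorem derivationOf_apply (X : Pol m M 1) (u : SmoothFun m M) :
    derivationOf X u = evalDiff (X : CotangentFun m M) u := rfl

end Homogeneous

section SectionModule

variable {m : ℕ} {M : Type*} [TopologicalSpace M] [ChartedSpace (EuclideanSpace ℝ (Fin m)) M]
  {Γ : Type*} [AddCommGroup Γ] [Module ℝ Γ] [Module (SmoothFun m M) Γ]
  [IsScalarTower ℝ (SmoothFun m M) Γ]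
  {W : M → Type*} [∀ x, AddCommGroup (W x)] [∀ x, Module ℝ (W x)]

/-! ### Modules of sections -/

/-- The properties of a module of smooth sections that matter here, in terms of the evaluations
`ev x`: sections are determined by their values, form a module over the smooth functions, do not
all vanish at any point, and can be glued along a partition of unity. -/
structure IsSectionModule (ev : ∀ x, Γ →ₗ[ℝ] W x) : Prop where
  ev_smul : ∀ (f : SmoothFun m M) (s : Γ) (x : M), ev x (f • s) = f x • ev x s
  ext : ∀ s t : Γ, (∀ x, ev x s = ev x t) → s = t
  exists_ne_zero : ∀ x, ∃ s, ev x s ≠ 0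
  glue : ∀ (ρ : SmoothPartitionOfUnity M (𝓡 m) M Set.univ) (s : M → Γ),
    ∃ t, ∀ x, ev x t = ∑ a ∈ ρ.finsupport x, ρ a x • ev x (s a)

/-- A connection: a lift of derivations of the functions to operators on sections, given at each
point by finitely many values of the derivation. The latter makes it linear over the smooth
functions and compatible with locally finite sums. -/
structure IsConnection (ev : ∀ x, Γ →ₗ[ℝ] W x)
    (conn : Derivation ℝ (SmoothFun m M) (SmoothFun m M) → Module.End ℝ Γ) : Prop where
  leibniz : ∀ D f, ad ℝ Γ f (conn D) = γ ℝ (SmoothFun m M) Γ (D f)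
  pointwise : ∀ s x, ∃ (n : ℕ) (f : Fin n → SmoothFun m M) (v : Fin n → W x), ∀ D,
    ev x (conn D s) = ∑ i, D (f i) x • v i

/-- `G` is the operator `∑ a, ρ a • T a`. -/
def IsGlue (ev : ∀ x, Γ →ₗ[ℝ] W x) (ρ : SmoothPartitionOfUnity M (𝓡 m) M Set.univ)
    (T : M → Module.End ℝ Γ) (G : Module.End ℝ Γ) : Prop :=
  ∀ s x, ev x (G s) = ∑ a ∈ ρ.finsupport x, ρ a x • ev x (T a s)

/-- A space of operators closed under locally finite convex combinations. -/
def IsGlueClosed (ev : ∀ x, Γ →ₗ[ℝ] W x) (B : Submodule ℝ (Module.End ℝ Γ)) : Prop :=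
  ∀ (ρ : SmoothPartitionOfUnity M (𝓡 m) M Set.univ) T G, IsGlue ev ρ T G → (∀ a, T a ∈ B) → G ∈ B

theorem exists_glue_smoothFun (ρ : SmoothPartitionOfUnity M (𝓡 m) M Set.univ)
    (w : M → SmoothFun m M) :
    ∃ f : SmoothFun m M, ∀ x, f x = ∑ a ∈ ρ.finsupport x, ρ a x • w a x :=
  ⟨⟨_, ρ.contMDiff_finsum_smul (n := (⊤ : ℕ∞)) (g := fun a x => w a x) fun a _ _ =>
    (w a).contMDiff.contMDiffAt⟩,
    fun x => (ρ.sum_finsupport_smul_eq_finsum x fun a x => w a x).symm⟩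

theorem exists_glue_derivation (ρ : SmoothPartitionOfUnity M (𝓡 m) M Set.univ)
    (D : M → Derivation ℝ (SmoothFun m M) (SmoothFun m M)) :
    ∃ D' : Derivation ℝ (SmoothFun m M) (SmoothFun m M),
      ∀ f x, D' f x = ∑ a ∈ ρ.finsupport x, ρ a x • D a f x := by
  choose d hd using fun f => exists_glue_smoothFun ρ fun a => D a f
  refine ⟨Derivation.mk' { toFun := d, map_add' := fun f g => ?_, map_smul' := fun r f => ?_ }
    fun f g => ?_, hd⟩
  · ext x
    change d (f + g) x = d f x + d g x
    simp only [hd, map_add, ContMDiffMap.coe_add, Pi.add_apply, smul_add, Finset.sum_add_distrib]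
  · ext x
    change d (r • f) x = r • d f x
    rw [hd, hd, Finset.smul_sum]
    refine Finset.sum_congr rfl fun a _ => ?_
    rw [Derivation.map_smul]
    exact mul_left_comm (ρ a x) r (D a f x)
  · ext x
    change d (f * g) x = f x * d g x + g x * d f x
    simp only [hd, Derivation.leibniz, smul_eq_mul, ContMDiffMap.coe_add, ContMDiffMap.coe_mul,
      Pi.add_apply, Pi.mul_apply, Finset.mul_sum, ← Finset.sum_add_distrib]
    exact Finset.sum_congr rfl fun a _ => by ring

namespace IsSectionModule

variable {ev : ∀ x, Γ →ₗ[ℝ] W x} (h : IsSectionModule (m := m) ev)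
include h

theorem γ_injective {f g : SmoothFun m M}
    (hfg : γ ℝ (SmoothFun m M) Γ f = γ ℝ (SmoothFun m M) Γ g) : f = g := by
  ext x
  obtain ⟨s, hs⟩ := h.exists_ne_zero x
  have h1 : f • s = g • s := LinearMap.congr_fun hfg s
  have h2 := congrArg (ev x) h1
  rw [h.ev_smul, h.ev_smul, ← sub_eq_zero, ← sub_smul] at h2
  exact sub_eq_zero.1 ((smul_eq_zero.1 h2).resolve_right hs)

omit [IsScalarTower ℝ (SmoothFun m M) Γ] in
theorem end_ext {S T : Module.End ℝ Γ} (hST : ∀ s x, ev x (S s) = ev x (T s)) : S = T :=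
  LinearMap.ext fun s => h.ext _ _ (hST s)

theorem ev_γ (f : SmoothFun m M) (s : Γ) (x : M) :
    ev x (γ ℝ (SmoothFun m M) Γ f s) = f x • ev x s := h.ev_smul f s x

omit [IsScalarTower ℝ (SmoothFun m M) Γ] in
theorem exists_isGlue (ρ : SmoothPartitionOfUnity M (𝓡 m) M Set.univ)
    (T : M → Module.End ℝ Γ) : ∃ G, IsGlue ev ρ T G := by
  choose g hg using fun s => h.glue ρ fun a => T a s
  refine ⟨{ toFun := g, map_add' := fun s t => h.ext _ _ fun x => ?_,
            map_smul' := fun r s => h.ext _ _ fun x => ?_ }, hg⟩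
  · simp only [hg, map_add, smul_add, Finset.sum_add_distrib]
  · simp only [hg, map_smul, RingHom.id_apply, Finset.smul_sum]
    exact Finset.sum_congr rfl fun a _ => smul_comm _ _ _

theorem isGlue_ad {ρ : SmoothPartitionOfUnity M (𝓡 m) M Set.univ} {T : M → Module.End ℝ Γ}
    {G : Module.End ℝ Γ} (hG : IsGlue ev ρ T G) (u : SmoothFun m M) :
    IsGlue ev ρ (fun a => ad ℝ Γ u (T a)) (ad ℝ Γ u G) := by
  intro s x
  simp only [ad_apply, LinearMap.sub_apply, Module.End.mul_apply, map_sub, h.ev_γ, smul_sub,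
    Finset.sum_sub_distrib, hG _ x, Finset.smul_sum]
  congr 1
  exact Finset.sum_congr rfl fun a _ => smul_comm _ _ _

theorem isGlue_ad_pow {ρ : SmoothPartitionOfUnity M (𝓡 m) M Set.univ} {T : M → Module.End ℝ Γ}
    {G : Module.End ℝ Γ} (hG : IsGlue ev ρ T G) (u : SmoothFun m M) (k : ℕ) :
    IsGlue ev ρ (fun a => (ad ℝ Γ u ^ k) (T a)) ((ad ℝ Γ u ^ k) G) := by
  induction k with
  | zero => exact hG
  | succ k ih =>
    simp only [pow_succ', Module.End.mul_apply]
    exact h.isGlue_ad ih u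

theorem isGlue_γ {ρ : SmoothPartitionOfUnity M (𝓡 m) M Set.univ} {w : M → SmoothFun m M}
    {G : Module.End ℝ Γ} (hG : IsGlue ev ρ (fun a => γ ℝ (SmoothFun m M) Γ (w a)) G)
    {f : SmoothFun m M} (hf : ∀ x, f x = ∑ a ∈ ρ.finsupport x, ρ a x • w a x) :
    G = γ ℝ (SmoothFun m M) Γ f := by
  refine h.end_ext fun s x => ?_
  rw [hG, h.ev_γ, hf, Finset.sum_smul]
  exact Finset.sum_congr rfl fun a _ => by rw [h.ev_γ, smul_assoc]

theorem isGlueClosed_commFilt {B : Submodule ℝ (Module.End ℝ Γ)} (hB : IsGlueClosed (m := m) ev B)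
    (k : ℕ) : IsGlueClosed (m := m) ev (commFilt (SmoothFun m M) B k) := by
  induction k with
  | zero => exact hB
  | succ k ih =>
    exact fun ρ T G hG hT => mem_commFilt_succ.2 fun u =>
      ih ρ _ _ (h.isGlue_ad hG u) fun a => mem_commFilt_succ.1 (hT a) u

end IsSectionModule

/-! ### The first-order operators of a connection -/

namespace IsConnection

variable {ev : ∀ x, Γ →ₗ[ℝ] W x} (h : IsSectionModule (m := m) ev)
  {conn : Derivation ℝ (SmoothFun m M) (SmoothFun m M) → Module.End ℝ Γ}
  (hc : IsConnection ev conn)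
include h hc

theorem conn_zero : conn 0 = 0 := by
  refine h.end_ext fun s x => ?_
  obtain ⟨n, f, v, hv⟩ := hc.pointwise s x
  simp [hv]

theorem conn_add (D D' : Derivation ℝ (SmoothFun m M) (SmoothFun m M)) :
    conn (D + D') = conn D + conn D' := by
  refine h.end_ext fun s x => ?_
  obtain ⟨n, f, v, hv⟩ := hc.pointwise s x
  simp [hv, add_smul, Finset.sum_add_distrib]

theorem conn_smul (g : SmoothFun m M) (D : Derivation ℝ (SmoothFun m M) (SmoothFun m M)) :
    conn (g • D) = γ ℝ (SmoothFun m M) Γ g * conn D := by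
  refine h.end_ext fun s x => ?_
  obtain ⟨n, f, v, hv⟩ := hc.pointwise s x
  rw [Module.End.mul_apply, h.ev_γ, hv, hv, Finset.smul_sum]
  exact Finset.sum_congr rfl fun i _ => mul_smul (g x) (D (f i) x) (v i)

/-- The operators `∇_D + γ w`. -/
def horizontal : Submodule ℝ (Module.End ℝ Γ) where
  carrier := {T | ∃ D w, T = conn D + γ ℝ (SmoothFun m M) Γ w}
  zero_mem' := ⟨0, 0, by rw [hc.conn_zero h, map_zero, add_zero]⟩
  add_mem' := by
    rintro _ _ ⟨D, w, rfl⟩ ⟨D', w', rfl⟩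
    exact ⟨D + D', w + w', by rw [hc.conn_add h, map_add]; abel⟩
  smul_mem' := by
    rintro r _ ⟨D, w, rfl⟩
    refine ⟨algebraMap ℝ (SmoothFun m M) r • D, r • w, ?_⟩
    rw [hc.conn_smul h, smul_add, map_smul, AlgHom.commutes, Algebra.smul_def]

theorem conn_mem_horizontal (D : Derivation ℝ (SmoothFun m M) (SmoothFun m M)) :
    conn D ∈ horizontal h hc := ⟨D, 0, by rw [map_zero, add_zero]⟩

theorem isHorizontal : IsHorizontal (A := SmoothFun m M) (horizontal h hc) where
  diffOp_zero_le := by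
    rintro _ ⟨w, rfl⟩
    exact ⟨0, w, by rw [hc.conn_zero h, zero_add]; rfl⟩
  le_diffOp_one := by
    rintro _ ⟨D, w, rfl⟩ u
    exact ⟨D u, by
      have h1 : ad ℝ Γ u (conn D + γ ℝ (SmoothFun m M) Γ w) = γ ℝ (SmoothFun m M) Γ (D u) := by
        rw [map_add, ad_γ, add_zero, hc.leibniz]
      exact h1.symm⟩
  γ_mul_mem := by
    rintro u _ ⟨D, w, rfl⟩
    exact ⟨u • D, u * w, by rw [hc.conn_smul h, mul_add, map_mul]⟩
  inf_le := by
    rintro _ ⟨⟨D, w, rfl⟩, hT⟩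
    have hD : D = 0 := by
      ext1 u
      refine h.γ_injective ?_
      have h1 := mem_orderLT_one.1 hT u
      rw [map_add, ad_γ, add_zero, hc.leibniz] at h1
      rw [h1, Derivation.zero_apply, map_zero]
    exact ⟨w, by rw [hD, hc.conn_zero h, zero_add]; rfl⟩

theorem isGlueClosed_horizontal : IsGlueClosed (m := m) ev (horizontal h hc) := by
  intro ρ T G hG hT
  choose D w hT using hT
  obtain ⟨D', hD'⟩ := exists_glue_derivation ρ D
  obtain ⟨w', hw'⟩ := exists_glue_smoothFun ρ w
  refine ⟨D', w', h.end_ext fun s x => ?_⟩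
  obtain ⟨n, f, v, hv⟩ := hc.pointwise s x
  rw [hG, LinearMap.add_apply, map_add, hv, h.ev_γ, hw', Finset.sum_smul]
  simp only [hT, LinearMap.add_apply, map_add, hv, h.ev_γ, hD', smul_add,
    Finset.sum_add_distrib, Finset.sum_smul, Finset.smul_sum, smul_assoc]
  rw [Finset.sum_comm]

end IsConnection

end SectionModule

section PrincipalSymbol

variable {m : ℕ} {M : Type*} [TopologicalSpace M] [ChartedSpace (EuclideanSpace ℝ (Fin m)) M]
  {Γ : Type*} [AddCommGroup Γ] [Module ℝ Γ] [Module (SmoothFun m M) Γ]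
  [IsScalarTower ℝ (SmoothFun m M) Γ]
  {W : M → Type*} [∀ x, AddCommGroup (W x)] [∀ x, Module ℝ (W x)]
  {ev : ∀ x, Γ →ₗ[ℝ] W x}
  [IsManifold (𝓡 m) ∞ M]

/-! ### Existence of principal symbols -/

/-- The function `w` in the definition of a principal symbol is determined by its values, and the
values it should have form a smooth function. -/
theorem isPrincipalSymbol_iff {k : ℕ} {T : Module.End ℝ Γ} {P : Pol m M k} :
    IsPrincipalSymbol k T P ↔ ∀ u, (ad ℝ Γ u ^ k) T
      = γ ℝ (SmoothFun m M) Γ ((k.factorial : ℝ) • evalDiff (P : CotangentFun m M) u) := by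
  refine forall_congr' fun u => ?_
  rw [iterBracket_eq]
  constructor
  · rintro ⟨w, hw, hwx⟩
    rw [hw, show w = (k.factorial : ℝ) • evalDiff (P : CotangentFun m M) u from
      ContMDiffMap.ext hwx]
  · exact fun h => ⟨_, h, fun x => rfl⟩

variable [T2Space M]

/-- The function by which the `k`-fold commutator with `u` multiplies depends on `u` through a
polynomial in the differential of `u` at each point. In the commutator power of order `k + 1`, one
of the arguments is isolated; at a point, the dependence on it is a point derivation, so this
argument may be replaced by a combination of local coframe functions, and the remaining commutators
are treated by induction. -/
theorem IsSectionModule.isHomogeneousFunctional (h : IsSectionModule (m := m) ev) {k : ℕ}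
    {T : Module.End ℝ Γ} (hT : T ∈ diffOp ℝ (SmoothFun m M) Γ k)
    {w : SmoothFun m M → SmoothFun m M}
    (hw : ∀ u, (ad ℝ Γ u ^ k) T = γ ℝ (SmoothFun m M) Γ (w u)) : IsHomogeneousFunctional k w := by
  induction k generalizing T w with
  | zero =>
    intro x
    refine ⟨MultilinearMap.constOfIsEmpty ℝ _ (w 0 x), fun u => ?_⟩
    have h1 : w u = w 0 := h.γ_injective ((hw u).symm.trans (hw 0))
    rw [h1]
    rfl
  | succ k ih =>
    intro x
    choose w' hw' using fun v u => ad_pow_mem_diffOp u k (ad_mem_diffOp hT v)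
    change ∀ v u, γ ℝ (SmoothFun m M) Γ (w' v u) = _ at hw'
    have hhom := fun v => ih (ad_mem_diffOp hT v) fun u => (hw' v u).symm
    obtain ⟨u, X, U, -, hx, hξ⟩ := exists_local_coframe (m := m) x
    choose b hb using fun i => hhom (u i) x
    choose L hL using fun i => exists_linear_of_pol_one (X i) x
    refine ⟨∑ i, LinearMap.uncurryLeft ((L i).smulRight (b i)), fun f => ?_⟩
    -- the commutator with `v` contributes a point derivation in `v`
    let ℓ : SmoothFun m M →ₗ[ℝ] ℝ :=
      { toFun := fun v => w' v f x
        map_add' := fun v v' => by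
          rw [show w' (v + v') f = w' v f + w' v' f from h.γ_injective (by
            simp only [hw', map_add, LinearMap.add_apply])]
          rfl
        map_smul' := fun r v => by
          rw [show w' (r • v) f = r • w' v f from h.γ_injective (by
            simp only [hw', map_smul, LinearMap.smul_apply])]
          rfl }
    have hℓ : ∀ v v', ℓ (v * v') = v x * ℓ v' + v' x * ℓ v := by
      intro v v'
      change w' (v * v') f x = v x * w' v' f x + v' x * w' v f x
      rw [show w' (v * v') f = w' v f * v' + v * w' v' f from h.γ_injective (by
        rw [map_add, map_mul, map_mul, hw', hw', hw', ad_mul_arg, map_add, ad_pow_mul_γ,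
          ad_pow_γ_mul])]
      change w' v f x * v' x + v x * w' v' f x = _
      ring
    have h0 := pointDerivation_eq_zero x ℓ hℓ
      (f := f - ∑ i, (X i : CotangentFun m M) ⟨x, diffAt x f⟩ • u i) (by
        change diffAt x _ = 0
        rw [map_sub, map_sum, sub_eq_zero]
        exact (hξ x hx (diffAt x f)).trans (Finset.sum_congr rfl fun i _ => by
          rw [map_smul]; rfl))
    rw [map_sub, map_sum, sub_eq_zero] at h0
    have hwf : w f = w' f f := h.γ_injective (by
      rw [hw', ← hw, pow_succ, Module.End.mul_apply])
    rw [hwf]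
    refine h0.trans ?_
    rw [sum_apply]
    refine Finset.sum_congr rfl fun i _ => ?_
    rw [map_smul, LinearMap.uncurryLeft_apply, LinearMap.smulRight_apply, smul_apply, hL]
    exact congrArg _ (hb i f)

theorem IsSectionModule.exists_isPrincipalSymbol (h : IsSectionModule (m := m) ev) {k : ℕ}
    {T : Module.End ℝ Γ} (hT : T ∈ diffOp ℝ (SmoothFun m M) Γ k) :
    ∃ P : Pol m M k, IsPrincipalSymbol k T P := by
  choose w hw using fun u => ad_pow_mem_diffOp u k hT
  have hom := h.isHomogeneousFunctional hT fun u => (hw u).symm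
  obtain ⟨P, hP⟩ := hom.exists_pol
  refine ⟨(k.factorial : ℝ)⁻¹ • P, isPrincipalSymbol_iff.2 fun u => ?_⟩
  rw [← hw u]
  change γ ℝ (SmoothFun m M) Γ (w u) = _
  congr 1
  rw [← hP u]
  ext x
  change evalDiff (P : CotangentFun m M) u x = (k.factorial : ℝ) • ((k.factorial : ℝ)⁻¹ • _)
  rw [smul_inv_smul₀ (by positivity)]
  rfl

theorem IsSectionModule.isPrincipalSymbol_unique (h : IsSectionModule (m := m) ev) {k : ℕ}
    {T : Module.End ℝ Γ} {P Q : Pol m M k} (hP : IsPrincipalSymbol k T P)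
    (hQ : IsPrincipalSymbol k T Q) : P = Q := by
  refine pol_ext fun u => ?_
  have h1 := h.γ_injective
    ((isPrincipalSymbol_iff.1 hP u).symm.trans (isPrincipalSymbol_iff.1 hQ u))
  exact smul_right_injective _ (by positivity : (k.factorial : ℝ) ≠ 0) h1

/-! ### Operators with prescribed principal symbol -/

variable [SecondCountableTopology M]

/-- Every homogeneous functional is the principal symbol of an operator built from products of
covariant derivatives. By Euler's identity it suffices to treat, near each point, the derivatives
of the functional along a local coframe; the local solutions are glued. -/
theorem IsConnection.exists_splitOp (h : IsSectionModule (m := m) ev)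
    {conn : Derivation ℝ (SmoothFun m M) (SmoothFun m M) → Module.End ℝ Γ}
    (hc : IsConnection ev conn) {k : ℕ} {p : SmoothFun m M → SmoothFun m M}
    (hp : IsHomogeneousFunctional k p) :
    ∃ T ∈ splitOp (A := SmoothFun m M) (hc.horizontal h) k, ∀ u, (ad ℝ Γ u ^ k) T
      = γ ℝ (SmoothFun m M) Γ ((k.factorial : ℝ) • p u) := by
  induction k generalizing p with
  | zero =>
    refine ⟨γ ℝ (SmoothFun m M) Γ (p 0), ⟨p 0, rfl⟩, fun u => ?_⟩
    have h1 : p u = p 0 := by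
      ext x
      obtain ⟨b, hb⟩ := hp x
      rw [hb, hb]
      exact congrArg b (Subsingleton.elim _ _)
    rw [h1, Nat.factorial_zero, Nat.cast_one, one_smul]
    rfl
  | succ k ih =>
    have := ChartedSpace.locallyCompactSpace (EuclideanSpace ℝ (Fin m)) M
    have hH := hc.isHorizontal h
    choose v X U hU hxU hξ using fun a : M => exists_local_coframe (m := m) a
    choose q hq hqp using fun a i => hp.exists_deriv (v a i)
    choose S hS hSq using fun a i => ih (hq a i)
    obtain ⟨ρ, hρ⟩ := SmoothPartitionOfUnity.exists_isSubordinate (𝓡 m)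
      (isClosed_univ (X := M)) U hU fun x _ => Set.mem_iUnion.2 ⟨x, hxU x⟩
    let T : M → Module.End ℝ Γ := fun a => ((k + 1 : ℕ) : ℝ)⁻¹ •
      ∑ i, S a i * conn (derivationOf (X a i))
    have hT : ∀ a, T a ∈ splitOp (A := SmoothFun m M) (hc.horizontal h) (k + 1) := fun a =>
      Submodule.smul_mem _ _ (Submodule.sum_mem _ fun i _ =>
        hH.mul_mem_splitOp (j := 1) (hS a i) (hc.conn_mem_horizontal h _))
    obtain ⟨G, hG⟩ := h.exists_isGlue ρ T
    refine ⟨G, h.isGlueClosed_commFilt (hc.isGlueClosed_horizontal h) k ρ T G hG hT, fun u => ?_⟩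
    have hTu : ∀ a, (ad ℝ Γ u ^ (k + 1)) (T a) = γ ℝ (SmoothFun m M) Γ
        (((k + 1 : ℕ) : ℝ)⁻¹ • ∑ i, ((k + 1).factorial : ℝ) •
          (q a i u * evalDiff (X a i : CotangentFun m M) u)) := by
      intro a
      simp only [T, map_smul, map_sum]
      congr 1
      refine Finset.sum_congr rfl fun i _ => ?_
      rw [ad_pow_mul u (hH.splitOp_le_diffOp k (hS a i))
        (hH.le_diffOp_one (hc.conn_mem_horizontal h (derivationOf (X a i)))), hSq, pow_one,
        hc.leibniz, derivationOf_apply, Nat.choose_succ_self_right, map_smul, smul_mul_assoc,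
        ← Nat.cast_smul_eq_nsmul ℝ, smul_smul, map_mul, Nat.factorial_succ, Nat.cast_mul]
    have hG' := h.isGlue_ad_pow hG u (k + 1)
    simp only [hTu] at hG'
    refine h.isGlue_γ hG' fun x => ?_
    obtain ⟨b, hb⟩ := hp x
    have hpx : ∀ a ∈ ρ.finsupport x, (((k + 1 : ℕ) : ℝ)⁻¹ • ∑ i, ((k + 1).factorial : ℝ) •
          (q a i u * evalDiff (X a i : CotangentFun m M) u)) x
        = ((k + 1).factorial : ℝ) * p u x := by
      intro a ha
      have hxa : x ∈ U a := hρ a (subset_tsupport _ ((ρ.mem_finsupport x).1 ha))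
      rw [← evalAt_apply, map_smul, map_sum]
      simp only [map_smul, evalAt_apply, smul_eq_mul]
      rw [← Finset.mul_sum, mul_left_comm]
      congr 1
      have h2 := sum_smul_linearDeriv b (diffAt x u) _ (fun i => diffAt x (v a i))
        (hξ a x hxa (diffAt x u))
      rw [inv_mul_eq_iff_eq_mul₀ (by positivity), hb, ← h2]
      refine Finset.sum_congr rfl fun i _ => ?_
      rw [← hqp a i x b hb]
      exact mul_comm _ _
    rw [Finset.sum_congr rfl fun a ha => by rw [hpx a ha], ← Finset.sum_smul,
      ρ.sum_finsupport x (Set.mem_univ x), one_smul]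
    rfl

end PrincipalSymbol

section Assembly

variable {m : ℕ} {M : Type*} [TopologicalSpace M] [ChartedSpace (EuclideanSpace ℝ (Fin m)) M]
  {Γ : Type*} [AddCommGroup Γ] [Module ℝ Γ] [Module (SmoothFun m M) Γ]
  [IsScalarTower ℝ (SmoothFun m M) Γ]
  {W : M → Type*} [∀ x, AddCommGroup (W x)] [∀ x, Module ℝ (W x)]
  {ev : ∀ x, Γ →ₗ[ℝ] W x}
  [IsManifold (𝓡 m) ∞ M]

/-- The algebra homomorphism of direct sums defined by a family of linear maps compatible with the
graded multiplications. -/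
def gradedAlgHom {R : Type*} [CommSemiring R] {C D : ℕ → Type*}
    [∀ i, AddCommMonoid (C i)] [∀ i, Module R (C i)] [DirectSum.GSemiring C]
    [DirectSum.GAlgebra R C] [∀ i, AddCommMonoid (D i)] [∀ i, Module R (D i)]
    [DirectSum.GSemiring D] [DirectSum.GAlgebra R D] (f : ∀ i, C i →ₗ[R] D i)
    (hone : f 0 GradedMonoid.GOne.one = GradedMonoid.GOne.one)
    (hmul : ∀ {i j} (a : C i) (b : C j),
      f (i + j) (GradedMonoid.GMul.mul a b) = GradedMonoid.GMul.mul (f i a) (f j b)) :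
    (⨁ i, C i) →ₐ[R] ⨁ i, D i :=
  DirectSum.toAlgebra R C (fun i => DirectSum.lof R ℕ D i ∘ₗ f i)
    (congrArg (DirectSum.of D 0) hone)
    (fun {i j} a b => (congrArg (DirectSum.of D (i + j)) (hmul a b)).trans
      (DirectSum.of_mul_of (f i a) (f j b)).symm)

theorem gradedAlgHom_of {R : Type*} [CommSemiring R] {C D : ℕ → Type*}
    [∀ i, AddCommMonoid (C i)] [∀ i, Module R (C i)] [DirectSum.GSemiring C]
    [DirectSum.GAlgebra R C] [∀ i, AddCommMonoid (D i)] [∀ i, Module R (D i)]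
    [DirectSum.GSemiring D] [DirectSum.GAlgebra R D] (f : ∀ i, C i →ₗ[R] D i)
    (hone : f 0 GradedMonoid.GOne.one = GradedMonoid.GOne.one)
    (hmul : ∀ {i j} (a : C i) (b : C j),
      f (i + j) (GradedMonoid.GMul.mul a b) = GradedMonoid.GMul.mul (f i a) (f j b))
    (i : ℕ) (a : C i) :
    gradedAlgHom f hone hmul (DirectSum.of C i a) = DirectSum.of D i (f i a) :=
  DirectSum.toAddMonoid_of (fun i => (DirectSum.lof R ℕ D i ∘ₗ f i).toAddMonoidHom) i a

/-! ### The algebra `Pol(T*M)` is reduced -/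

theorem pol_apply_smul {k : ℕ} (P : Pol m M k) (x : M) (ξ : TangentSpace (𝓡 m) x →L[ℝ] ℝ)
    (t : ℝ) :
    (P : CotangentFun m M) ⟨x, t • ξ⟩ = t ^ k * (P : CotangentFun m M) ⟨x, ξ⟩ := by
  obtain ⟨b, hb⟩ := P.2 x
  rw [hb, hb, b.map_smul_univ (fun _ => t) fun _ => ξ]
  simp

/-- If the homogeneous elements of degree `i` scale by `t ^ i` along a ray, then the components of
an element of a graded algebra are, along that ray, the coefficients of a polynomial in `t`; they
vanish when the element does. -/
theorem apply_eq_zero_of_coeAlgHom_eq_zero {R : Type*} [CommRing R] [Algebra ℝ R]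
    (B : ℕ → Submodule ℝ R) [SetLike.GradedMonoid B] (φ : ℝ → R →ₗ[ℝ] ℝ) (c : R → ℝ)
    (hφ : ∀ t i (f : B i), φ t f = t ^ i * c f) {P : ⨁ i, B i}
    (hP : DirectSum.coeAlgHom B P = 0) (hc : c 0 = 0) (k : ℕ) : c (P k) = 0 := by
  classical
  have hsum : ∑ i ∈ P.support, (P i : R) = 0 := by
    rw [← hP]
    conv_rhs => rw [← DirectSum.sum_support_of P, map_sum]
    exact Finset.sum_congr rfl fun i _ => (DirectSum.coeAlgHom_of B i (P i)).symm
  let q : Polynomial ℝ := ∑ i ∈ P.support, Polynomial.monomial i (c (P i))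
  have hq : q = 0 := by
    refine Polynomial.funext fun t => ?_
    have h1 := congrArg (φ t) hsum
    rw [map_sum, map_zero] at h1
    rw [Polynomial.eval_zero, ← h1, Polynomial.eval_finsetSum]
    refine Finset.sum_congr rfl fun i _ => ?_
    rw [Polynomial.eval_monomial, mul_comm, hφ]
  have h2 := congrArg (fun r => Polynomial.coeff r k) hq
  simp only [q, Polynomial.finsetSum_coeff, Polynomial.coeff_monomial, Finset.sum_ite_eq',
    Polynomial.coeff_zero] at h2
  by_cases hk : k ∈ P.support
  · rwa [if_pos hk] at h2
  · rw [DFinsupp.notMem_support_iff.1 hk]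
    exact hc

theorem coeAlgHom_pol_injective : Function.Injective (DirectSum.coeAlgHom (Pol m M)) := by
  rw [injective_iff_map_eq_zero]
  intro P hP
  refine DFinsupp.ext fun k => Subtype.ext (ContMDiffMap.ext ?_)
  rintro ⟨x, ξ⟩
  let evc : ℝ → CotangentFun m M →ₗ[ℝ] ℝ := fun t =>
    { toFun := fun f => f ⟨x, t • ξ⟩, map_add' := fun _ _ => rfl, map_smul' := fun _ _ => rfl }
  exact apply_eq_zero_of_coeAlgHom_eq_zero (Pol m M) evc (fun f => f ⟨x, ξ⟩)
    (fun t i f => pol_apply_smul f x ξ t) hP rfl k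

/-- `Pol(T*M)` is reduced, being a subalgebra of the functions on `T*M`. -/
theorem polAlg_eq_zero_of_sq {P : PolAlg m M} (hP : P ^ 2 = 0) : P = 0 := by
  refine coeAlgHom_pol_injective ?_
  have h1 := congrArg (DirectSum.coeAlgHom (Pol m M)) hP
  rw [map_pow, map_zero] at h1
  rw [map_zero]
  ext y
  exact pow_eq_zero_iff (two_ne_zero) |>.1 (congrArg (fun f : CotangentFun m M => f y) h1)

/-- The product of homogeneous fibrewise polynomial functions. -/
def polMul {i j : ℕ} (P : Pol m M i) (Q : Pol m M j) : Pol m M (i + j) :=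
  ⟨P * Q, SetLike.mul_mem_graded P.2 Q.2⟩

variable (m M) in
/-- The constant function `1`, as a fibrewise polynomial function of degree `0`. -/
def polOne : Pol m M 0 := ⟨1, SetLike.one_mem_graded _⟩

/-! ### The principal symbol homomorphism -/

theorem IsPrincipalSymbol.add {k : ℕ} {S T : Module.End ℝ Γ} {P Q : Pol m M k}
    (hS : IsPrincipalSymbol k S P) (hT : IsPrincipalSymbol k T Q) :
    IsPrincipalSymbol k (S + T) (P + Q) := by
  rw [isPrincipalSymbol_iff] at *
  intro u
  rw [map_add, hS, hT, ← map_add, ← smul_add]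
  rfl

theorem IsPrincipalSymbol.smul {k : ℕ} {T : Module.End ℝ Γ} {P : Pol m M k} (r : ℝ)
    (hT : IsPrincipalSymbol k T P) : IsPrincipalSymbol k (r • T) (r • P) := by
  rw [isPrincipalSymbol_iff] at *
  intro u
  rw [map_smul, hT, ← map_smul, smul_comm]
  rfl

theorem IsPrincipalSymbol.mul {i j : ℕ} {S T : Module.End ℝ Γ} {P : Pol m M i} {Q : Pol m M j}
    (hSi : S ∈ diffOp ℝ (SmoothFun m M) Γ i) (hTj : T ∈ diffOp ℝ (SmoothFun m M) Γ j)
    (hS : IsPrincipalSymbol i S P) (hT : IsPrincipalSymbol j T Q) :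
    IsPrincipalSymbol (i + j) (S * T) (polMul P Q) := by
  rw [isPrincipalSymbol_iff] at *
  intro u
  rw [ad_pow_mul u hSi hTj, hS, hT, ← map_mul, ← map_nsmul]
  congr 1
  have hij := Nat.choose_mul_factorial_mul_factorial (Nat.le_add_right i j)
  rw [Nat.add_sub_cancel_left] at hij
  rw [smul_mul_smul_comm, ← Nat.cast_smul_eq_nsmul ℝ, smul_smul, ← mul_assoc, ← Nat.cast_mul,
    ← Nat.cast_mul, hij]
  rfl

theorem isPrincipalSymbol_one : IsPrincipalSymbol (m := m) (M := M) 0 (1 : Module.End ℝ Γ)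
    (polOne m M) := by
  rw [isPrincipalSymbol_iff]
  intro u
  rw [Nat.factorial_zero, Nat.cast_one, one_smul]
  exact (map_one (γ ℝ (SmoothFun m M) Γ)).symm

/-- The principal symbol of order `k` vanishes exactly for the operators of order less than `k` in
the usual sense, which need not lie in `P^(k-1)`. -/
theorem isPrincipalSymbol_zero_iff {k : ℕ} {T : Module.End ℝ Γ} :
    IsPrincipalSymbol (m := m) (M := M) k T 0 ↔ T ∈ orderLT ℝ (SmoothFun m M) Γ k := by
  have h0 : ∀ u : SmoothFun m M, γ ℝ (SmoothFun m M) Γ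
      ((k.factorial : ℝ) • evalDiff ((0 : Pol m M k) : CotangentFun m M) u) = 0 := fun u => by
    rw [show evalDiff ((0 : Pol m M k) : CotangentFun m M) u = 0 from rfl, smul_zero, map_zero]
  rw [isPrincipalSymbol_iff]
  exact ⟨fun h => mem_orderLT_of_ad_pow_eq_zero fun u => (h u).trans (h0 u),
    fun h u => (ad_pow_eq_zero u k h).trans (h0 u).symm⟩

namespace IsSectionModule

variable [T2Space M] (h : IsSectionModule (m := m) ev)
include h

/-- The principal symbol of order `k` of operators in `P^k`. -/
def princ (k : ℕ) : diffOp ℝ (SmoothFun m M) Γ k →ₗ[ℝ] Pol m M k where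
  toFun T := (h.exists_isPrincipalSymbol T.2).choose
  map_add' S T := h.isPrincipalSymbol_unique (h.exists_isPrincipalSymbol (S + T).2).choose_spec
    ((h.exists_isPrincipalSymbol S.2).choose_spec.add (h.exists_isPrincipalSymbol T.2).choose_spec)
  map_smul' r T := h.isPrincipalSymbol_unique (h.exists_isPrincipalSymbol (r • T).2).choose_spec
    ((h.exists_isPrincipalSymbol T.2).choose_spec.smul r)

theorem isPrincipalSymbol_princ {k : ℕ} (T : diffOp ℝ (SmoothFun m M) Γ k) :
    IsPrincipalSymbol k (T : Module.End ℝ Γ) (h.princ k T) :=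
  (h.exists_isPrincipalSymbol T.2).choose_spec

theorem princ_eq {k : ℕ} {T : diffOp ℝ (SmoothFun m M) Γ k} {P : Pol m M k}
    (hP : IsPrincipalSymbol k (T : Module.End ℝ Γ) P) : h.princ k T = P :=
  h.isPrincipalSymbol_unique (h.isPrincipalSymbol_princ T) hP

theorem princ_eq_zero_iff {k : ℕ} {T : diffOp ℝ (SmoothFun m M) Γ k} :
    h.princ k T = 0 ↔ T.1 ∈ orderLT ℝ (SmoothFun m M) Γ k := by
  rw [← isPrincipalSymbol_zero_iff]
  exact ⟨fun hT => hT ▸ h.isPrincipalSymbol_princ T, fun hT => h.princ_eq hT⟩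

/-- The principal symbol as a map on `S^k = P^k / P^(k-1)`. -/
def symbolMap (k : ℕ) : SymbolSpace ℝ (SmoothFun m M) Γ k →ₗ[ℝ] Pol m M k :=
  Submodule.liftQ _ (h.princ k) fun _ hT => h.princ_eq_zero_iff.2 (diffOpBelow_le_orderLT k hT)

theorem symbolMap_symbol {k : ℕ} (T : diffOp ℝ (SmoothFun m M) Γ k) :
    h.symbolMap k (symbol T) = h.princ k T := rfl

theorem symbolMap_one :
    h.symbolMap 0 (symbol ⟨γ ℝ (SmoothFun m M) Γ 1, γ_mem 1⟩) = polOne m M := by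
  rw [h.symbolMap_symbol]
  refine h.princ_eq ?_
  change IsPrincipalSymbol 0 (γ ℝ (SmoothFun m M) Γ 1) _
  rw [map_one]
  exact isPrincipalSymbol_one

theorem symbolMap_mul {i j : ℕ} (p : SymbolSpace ℝ (SmoothFun m M) Γ i)
    (q : SymbolSpace ℝ (SmoothFun m M) Γ j) :
    h.symbolMap (i + j) (symbolMul i j p q) = polMul (h.symbolMap i p) (h.symbolMap j q) := by
  obtain ⟨S, rfl⟩ := symbol_surjective p
  obtain ⟨T, rfl⟩ := symbol_surjective q
  rw [symbolMul_symbol]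
  exact h.princ_eq ((h.isPrincipalSymbol_princ S).mul S.2 T.2 (h.isPrincipalSymbol_princ T))

/-- The principal symbol homomorphism `S(P(E,M)) → Pol(T*M)`. -/
def symbolHom : Symbols ℝ (SmoothFun m M) Γ →ₐ[ℝ] PolAlg m M :=
  gradedAlgHom h.symbolMap h.symbolMap_one h.symbolMap_mul

theorem symbolHom_of {k : ℕ} (p : SymbolSpace ℝ (SmoothFun m M) Γ k) :
    h.symbolHom (DirectSum.of (SymbolSpace ℝ (SmoothFun m M) Γ) k p)
      = DirectSum.of (fun i => Pol m M i) k (h.symbolMap k p) :=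
  gradedAlgHom_of h.symbolMap h.symbolMap_one h.symbolMap_mul k p

theorem isPrincipalSymbolMap_symbolHom : IsPrincipalSymbolMap h.symbolHom := fun k T =>
  ⟨h.princ k T, h.isPrincipalSymbol_princ T, h.symbolHom_of (symbol T)⟩

theorem eq_symbolHom {δ : Symbols ℝ (SmoothFun m M) Γ →ₐ[ℝ] PolAlg m M}
    (hδ : IsPrincipalSymbolMap δ) : δ = h.symbolHom := by
  refine DirectSum.algHom_ext _ _ fun k p => ?_
  obtain ⟨T, rfl⟩ := symbol_surjective p
  obtain ⟨P, hP, hδP⟩ := hδ k T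
  change δ (DirectSum.of _ k (symbol T)) = h.symbolHom (DirectSum.of _ k (symbol T))
  rw [hδP, h.symbolHom_of, h.symbolMap_symbol, h.princ_eq hP]

theorem symbolHom_apply (P : Symbols ℝ (SmoothFun m M) Γ) (k : ℕ) :
    h.symbolHom P k = h.symbolMap k (P k) := by
  induction P using DirectSum.induction_on with
  | zero => rw [map_zero, DirectSum.zero_apply, DirectSum.zero_apply, map_zero]
  | of i p =>
    rw [h.symbolHom_of]
    by_cases hik : i = k
    · subst hik
      rw [DirectSum.of_eq_same, DirectSum.of_eq_same]
    · rw [DirectSum.of_eq_of_ne _ _ _ (Ne.symm hik), DirectSum.of_eq_of_ne _ _ _ (Ne.symm hik),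
        map_zero]
  | add P Q hP hQ => rw [map_add, DirectSum.add_apply, DirectSum.add_apply, map_add, hP, hQ]

/-- The kernel of the principal symbol homomorphism squares to zero. -/
theorem mul_eq_zero_of_symbolHom_eq_zero {P Q : Symbols ℝ (SmoothFun m M) Γ}
    (hP : h.symbolHom P = 0) (hQ : h.symbolHom Q = 0) : P * Q = 0 := by
  classical
  rw [← DirectSum.sum_support_of P, ← DirectSum.sum_support_of Q, Finset.sum_mul_sum]
  refine Finset.sum_eq_zero fun i _ => Finset.sum_eq_zero fun j _ => ?_
  have hPi : h.symbolMap i (P i) = 0 := by rw [← h.symbolHom_apply, hP]; rfl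
  have hQj : h.symbolMap j (Q j) = 0 := by rw [← h.symbolHom_apply, hQ]; rfl
  obtain ⟨S, hS⟩ := symbol_surjective (P i)
  obtain ⟨T, hT⟩ := symbol_surjective (Q j)
  rw [← hS, h.symbolMap_symbol, h.princ_eq_zero_iff] at hPi
  rw [← hT, h.symbolMap_symbol, h.princ_eq_zero_iff] at hQj
  rw [← hS, ← hT, DirectSum.of_mul_of]
  change DirectSum.of _ (i + j) (symbol _) = 0
  rw [symbol_eq_zero_iff.2 (mul_mem_diffOpBelow_of_orderLT hPi hQj), map_zero]

/-- The elements of square zero are those with vanishing principal symbol, as `Pol(T*M)` is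
reduced. -/
theorem sq_eq_zero_iff {P : Symbols ℝ (SmoothFun m M) Γ} : P ^ 2 = 0 ↔ h.symbolHom P = 0 :=
  ⟨fun hP => polAlg_eq_zero_of_sq (by rw [← map_pow, hP, map_zero]), fun hP => by
    rw [sq, h.mul_eq_zero_of_symbolHom_eq_zero hP hP]⟩

/-- If the operators of order zero are the multiplication operators, then the principal symbol
homomorphism is injective. -/
theorem symbolHom_injective (h0 : orderLT ℝ (SmoothFun m M) Γ 1 ≤ diffOp ℝ (SmoothFun m M) Γ 0) :
    Function.Injective h.symbolHom := by
  rw [injective_iff_map_eq_zero]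
  intro P hP
  refine DFinsupp.ext fun k => ?_
  have hPk : h.symbolMap k (P k) = 0 := by rw [← h.symbolHom_apply, hP]; rfl
  obtain ⟨T, hT⟩ := symbol_surjective (P k)
  rw [← hT, h.symbolMap_symbol, h.princ_eq_zero_iff] at hPk
  rw [← hT]
  refine symbol_eq_zero_iff.2 ?_
  cases k with
  | zero => exact hPk
  | succ k =>
    change T.1 ∈ diffOp ℝ (SmoothFun m M) Γ k
    rw [diffOp_eq_commFilt]
    rw [orderLT_succ_eq] at hPk
    exact commFilt_mono h0 k hPk

end IsSectionModule

/-! ### The splitting defined by a connection -/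

namespace IsConnection

variable [T2Space M] [SecondCountableTopology M] (h : IsSectionModule (m := m) ev)
  {conn : Derivation ℝ (SmoothFun m M) (SmoothFun m M) → Module.End ℝ Γ}
  (hc : IsConnection ev conn)
include h hc

theorem exists_splitOp_pol {k : ℕ} (P : Pol m M k) :
    ∃ T : diffOp ℝ (SmoothFun m M) Γ k, T.1 ∈ splitOp (A := SmoothFun m M) (hc.horizontal h) k ∧
      IsPrincipalSymbol k T.1 P := by
  obtain ⟨T, hT, hTP⟩ := hc.exists_splitOp h (isHomogeneousFunctional_evalDiff P)
  exact ⟨⟨T, (hc.isHorizontal h).splitOp_le_diffOp k hT⟩, hT, isPrincipalSymbol_iff.2 hTP⟩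

omit [SecondCountableTopology M] in
/-- The class of an operator built from the connection is determined by its principal symbol. -/
theorem symbol_eq_of_splitOp {k : ℕ} {S T : diffOp ℝ (SmoothFun m M) Γ k}
    (hS : S.1 ∈ splitOp (A := SmoothFun m M) (hc.horizontal h) k)
    (hT : T.1 ∈ splitOp (A := SmoothFun m M) (hc.horizontal h) k)
    (hST : h.princ k S = h.princ k T) : symbol S = symbol T :=
  symbol_eq_iff.2 ((hc.isHorizontal h).mem_diffOpBelow (Submodule.sub_mem _ hS hT)
    (h.princ_eq_zero_iff (T := S - T) |>.1 (by rw [map_sub, hST, sub_self])))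

/-- The symbol class with a given principal symbol that is represented by an operator built from
the connection. -/
def liftSymbol (k : ℕ) : Pol m M k →ₗ[ℝ] SymbolSpace ℝ (SmoothFun m M) Γ k where
  toFun P := symbol (hc.exists_splitOp_pol h P).choose
  map_add' P Q := by
    rw [← map_add]
    refine hc.symbol_eq_of_splitOp h (hc.exists_splitOp_pol h _).choose_spec.1
      (Submodule.add_mem _ (hc.exists_splitOp_pol h _).choose_spec.1
        (hc.exists_splitOp_pol h _).choose_spec.1) ?_
    rw [map_add, h.princ_eq (hc.exists_splitOp_pol h _).choose_spec.2,
      h.princ_eq (hc.exists_splitOp_pol h _).choose_spec.2,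
      h.princ_eq (hc.exists_splitOp_pol h _).choose_spec.2]
  map_smul' r P := by
    rw [← map_smul]
    refine hc.symbol_eq_of_splitOp h (hc.exists_splitOp_pol h _).choose_spec.1
      (Submodule.smul_mem _ _ (hc.exists_splitOp_pol h _).choose_spec.1) ?_
    rw [map_smul, h.princ_eq (hc.exists_splitOp_pol h _).choose_spec.2,
      h.princ_eq (hc.exists_splitOp_pol h _).choose_spec.2]
    rfl

theorem liftSymbol_eq {k : ℕ} {P : Pol m M k} {T : diffOp ℝ (SmoothFun m M) Γ k}
    (hT : T.1 ∈ splitOp (A := SmoothFun m M) (hc.horizontal h) k)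
    (hTP : IsPrincipalSymbol k T.1 P) : hc.liftSymbol h k P = symbol T :=
  hc.symbol_eq_of_splitOp h (hc.exists_splitOp_pol h _).choose_spec.1 hT (by
    rw [h.princ_eq (hc.exists_splitOp_pol h _).choose_spec.2, h.princ_eq hTP])

theorem liftSymbol_one :
    hc.liftSymbol h 0 (polOne m M) = symbol ⟨γ ℝ (SmoothFun m M) Γ 1, γ_mem 1⟩ :=
  hc.liftSymbol_eq h (γ_mem 1) (by
    change IsPrincipalSymbol 0 (γ ℝ (SmoothFun m M) Γ 1) _
    rw [map_one]
    exact isPrincipalSymbol_one)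

theorem liftSymbol_mul {i j : ℕ} (P : Pol m M i) (Q : Pol m M j) :
    hc.liftSymbol h (i + j) (polMul P Q)
      = symbolMul i j (hc.liftSymbol h i P) (hc.liftSymbol h j Q) := by
  obtain ⟨S, hS, hSP⟩ := hc.exists_splitOp_pol h P
  obtain ⟨T, hT, hTQ⟩ := hc.exists_splitOp_pol h Q
  rw [hc.liftSymbol_eq h hS hSP, hc.liftSymbol_eq h hT hTQ, symbolMul_symbol]
  exact hc.liftSymbol_eq h ((hc.isHorizontal h).mul_mem_splitOp hS hT) (hSP.mul S.2 T.2 hTQ)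

/-- The graded algebra homomorphism `Pol(T*M) → S(P(E,M))` defined by a connection. -/
def splitHom : PolAlg m M →ₐ[ℝ] Symbols ℝ (SmoothFun m M) Γ :=
  gradedAlgHom (hc.liftSymbol h) (hc.liftSymbol_one h) (hc.liftSymbol_mul h)

theorem splitHom_of {k : ℕ} (P : Pol m M k) :
    hc.splitHom h (DirectSum.of (fun i => Pol m M i) k P)
      = DirectSum.of (SymbolSpace ℝ (SmoothFun m M) Γ) k (hc.liftSymbol h k P) :=
  gradedAlgHom_of (D := SymbolSpace ℝ (SmoothFun m M) Γ) (hc.liftSymbol h) (hc.liftSymbol_one h)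
    (hc.liftSymbol_mul h) k P

theorem symbolHom_comp_splitHom :
    h.symbolHom.comp (hc.splitHom h) = AlgHom.id ℝ (PolAlg m M) := by
  refine DirectSum.algHom_ext _ _ fun k P => ?_
  change h.symbolHom (hc.splitHom h (DirectSum.of _ k P)) = DirectSum.of (fun i => Pol m M i) k P
  obtain ⟨T, hT, hTP⟩ := hc.exists_splitOp_pol h P
  rw [hc.splitHom_of h, h.symbolHom_of, hc.liftSymbol_eq h hT hTP, h.symbolMap_symbol,
    h.princ_eq hTP]

theorem symbolHom_surjective : Function.Surjective h.symbolHom := fun P =>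
  ⟨hc.splitHom h P, DFunLike.congr_fun (hc.symbolHom_comp_splitHom h) P⟩

theorem isCompl_ker_range : IsCompl ((RingHom.ker h.symbolHom).restrictScalars ℝ)
    (Subalgebra.toSubmodule (hc.splitHom h).range) := by
  have hid : ∀ P, h.symbolHom (hc.splitHom h P) = P :=
    DFunLike.congr_fun (hc.symbolHom_comp_splitHom h)
  refine isCompl_iff.2 ⟨Submodule.disjoint_def.2 ?_, codisjoint_iff.2 (eq_top_iff.2 fun P _ => ?_)⟩
  · rintro _ hP ⟨Q, rfl⟩
    have hQ : h.symbolHom (hc.splitHom h Q) = 0 := hP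
    rw [hid] at hQ
    change hc.splitHom h Q = 0
    rw [hQ, map_zero]
  · refine Submodule.mem_sup.2 ⟨P - hc.splitHom h (h.symbolHom P), ?_,
      hc.splitHom h (h.symbolHom P), ⟨_, rfl⟩, sub_add_cancel _ _⟩
    change h.symbolHom _ = 0
    rw [map_sub, hid, sub_self]

end IsConnection

end Assembly

/-! ### Scalar operators -/

section Scalar

variable {m : ℕ} {M : Type*} [TopologicalSpace M] [ChartedSpace (EuclideanSpace ℝ (Fin m)) M]

theorem isSectionModule_smoothFun :
    IsSectionModule (m := m) (Γ := SmoothFun m M) (W := fun _ : M => ℝ) evalAt where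
  ev_smul _ _ _ := rfl
  ext _ _ h := ContMDiffMap.ext h
  exists_ne_zero _ := ⟨1, one_ne_zero⟩
  glue ρ s := exists_glue_smoothFun ρ s

/-- Derivations act on functions as a flat connection. -/
theorem isConnection_smoothFun :
    IsConnection (m := m) (Γ := SmoothFun m M) (W := fun _ : M => ℝ) evalAt
      (fun D => D.toLinearMap) where
  leibniz D f := LinearMap.ext fun g => by
    change D (f • g) - f * D g = D f * g
    rw [smul_eq_mul, D.leibniz, smul_eq_mul, smul_eq_mul, add_sub_cancel_left, mul_comm]
  pointwise s x := ⟨1, fun _ => s, fun _ => 1, fun D => by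
    rw [Fin.sum_univ_one, smul_eq_mul, mul_one]
    rfl⟩

/-- An operator on functions that commutes with multiplications is the multiplication by its value
at the function `1`. -/
theorem orderLT_one_le_smoothFun :
    orderLT ℝ (SmoothFun m M) (SmoothFun m M) 1 ≤ diffOp ℝ (SmoothFun m M) (SmoothFun m M) 0 := by
  intro T hT
  refine ⟨T 1, LinearMap.ext fun f => ?_⟩
  have h1 := LinearMap.congr_fun (mem_orderLT_one.1 hT f) 1
  have h2 : T (f * 1) - f * T 1 = 0 := h1
  rw [mul_one, sub_eq_zero] at h2
  rw [h2]
  exact mul_comm (T 1) f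

end Scalar

/-! ### Sections of vector bundles -/

section Sections

variable {m : ℕ} {M : Type*} [TopologicalSpace M] [ChartedSpace (EuclideanSpace ℝ (Fin m)) M]
  {F : Type*} [NormedAddCommGroup F] [NormedSpace ℝ F]
  {V : M → Type*} [TopologicalSpace (Bundle.TotalSpace F V)]
  [∀ x, AddCommGroup (V x)] [∀ x, Module ℝ (V x)] [∀ x, TopologicalSpace (V x)]
  [FiberBundle F V] [VectorBundle ℝ F V]

variable (m F V) in
/-- The value of a section at `x`. -/
def secEval (x : M) : SmoothSec m F V →ₗ[ℝ] V x where
  toFun s := s x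
  map_add' _ _ := rfl
  map_smul' _ _ := rfl

theorem sum_section_apply {ι : Type*} (t : Finset ι) (s : ι → SmoothSec m F V) (x : M) :
    (∑ i ∈ t, s i) x = ∑ i ∈ t, s i x := map_sum (secEval m F V x) s t

theorem exists_glue_section (ρ : SmoothPartitionOfUnity M (𝓡 m) M Set.univ)
    (s : M → SmoothSec m F V) :
    ∃ t : SmoothSec m F V, ∀ x, t x = ∑ a ∈ ρ.finsupport x, ρ a x • s a x := by
  refine ⟨⟨fun x => ∑ᶠ a, ρ a x • s a x, ContMDiff.finsum_section_of_locallyFinite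
    (ρ.locallyFinite.subset fun a x hx => ?_) fun a =>
      (ρ a).contMDiff.smul_section (s a).contMDiff⟩, fun x => ?_⟩
  · intro h0
    exact hx (by rw [h0, zero_smul])
  · change ∑ᶠ a, ρ a x • s a x = _
    refine finsum_eq_sum_of_support_subset _ fun a ha => ?_
    rw [ρ.coe_finsupport]
    intro h0
    exact ha (by change ρ a x • s a x = 0; rw [show ρ a x = 0 from h0, zero_smul])

variable [IsManifold (𝓡 m) ∞ M] [T2Space M] [FiniteDimensional ℝ F]
  [ContMDiffVectorBundle ∞ F V (𝓡 m)]

/-- Near each point, sections are the combinations of a finite family of global sections, with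
coefficients depending linearly on the section: cut off a local frame and its coefficients. -/
theorem exists_local_dual_basis (x₀ : M) :
    ∃ (e : Fin (Module.finrank ℝ F) → SmoothSec m F V)
      (c : Fin (Module.finrank ℝ F) → SmoothSec m F V →ₗ[SmoothFun m M] SmoothFun m M)
      (U : Set M), IsOpen U ∧ x₀ ∈ U ∧ (∀ i, e i x₀ ≠ 0) ∧
        ∀ s, ∀ x ∈ U, s x = ∑ i, c i s x • e i x := by
  have : ContMDiffVectorBundle 1 F V (𝓡 m) := ContMDiffVectorBundle.of_le (n := ∞) (by simp)
  let t := trivializationAt F V x₀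
  let b := Module.finBasis ℝ F
  obtain ⟨χ, -, hχ⟩ := (SmoothBumpFunction.nhds_basis_tsupport (I := 𝓡 m) x₀).mem_iff.1
    (t.open_baseSet.mem_nhds (FiberBundle.mem_baseSet_trivializationAt F V x₀))
  obtain ⟨U, hU, hUo, hxU⟩ := eventually_nhds_iff.1 χ.eventuallyEq_one
  have hUt : ∀ x ∈ U, x ∈ t.baseSet := fun x hx =>
    hχ (subset_tsupport _ (by rw [Function.mem_support, hU x hx]; exact one_ne_zero))
  let e : Fin (Module.finrank ℝ F) → SmoothSec m F V := fun i => ⟨(χ : M → ℝ) • t.localFrame b i,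
    ContMDiffOn.smul_section_of_tsupport χ.contMDiff.contMDiffOn t.open_baseSet hχ
      (t.contMDiffOn_localFrame_baseSet ∞ b i)⟩
  let c : Fin (Module.finrank ℝ F) → SmoothSec m F V →ₗ[SmoothFun m M] SmoothFun m M := fun i =>
    { toFun := fun s => ⟨fun x => χ x • t.localFrameCoeff (𝓡 m) b i x (s x),
        contMDiff_of_tsupport fun x hx =>
          (χ.contMDiff.contMDiffAt).smul (contMDiffAt_localFrameCoeff b
            (hχ (tsupport_smul_subset_left _ _ hx)) s.contMDiff.contMDiffAt i)⟩
      map_add' := fun s s' => ContMDiffMap.ext fun x => by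
        change χ x • t.localFrameCoeff (𝓡 m) b i x (s x + s' x) = _
        rw [map_add, smul_add]
        rfl
      map_smul' := fun f s => ContMDiffMap.ext fun x => by
        change χ x • t.localFrameCoeff (𝓡 m) b i x (f x • s x) = _
        rw [map_smul, smul_comm]
        rfl }
  refine ⟨e, c, U, hUo, hxU, fun i => ?_, fun s x hx => ?_⟩
  · change χ x₀ • t.localFrame b i x₀ ≠ 0
    rw [hU x₀ hxU, Pi.one_apply, one_smul, t.localFrame_apply_of_mem_baseSet b (hUt x₀ hxU)]
    exact (t.basisAt b (hUt x₀ hxU)).ne_zero i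
  refine (t.eq_sum_localFrameCoeff_smul (I := 𝓡 m) (b := b) (s := s) (hUt x hx)).trans
    (Finset.sum_congr rfl fun i _ => ?_)
  change _ = (χ x • t.localFrameCoeff (𝓡 m) b i x (s x)) • χ x • t.localFrame b i x
  rw [hU x hx, Pi.one_apply, one_smul, one_smul]

theorem isSectionModule_section (hF : 0 < Module.finrank ℝ F) :
    IsSectionModule (m := m) (secEval m F V) where
  ev_smul _ _ _ := rfl
  ext _ _ h := ContMDiffSection.ext h
  glue ρ s := exists_glue_section ρ s
  exists_ne_zero x := by
    obtain ⟨e, c, U, -, -, he, -⟩ := exists_local_dual_basis (m := m) (F := F) (V := V) x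
    exact ⟨e ⟨0, hF⟩, he _⟩

/-- Every vector bundle has a connection: glue the operators `s ↦ ∑ i, D (c i s) • e i` obtained from
local dual bases along a partition of unity. -/
theorem exists_isConnection_section [SecondCountableTopology M] (hF : 0 < Module.finrank ℝ F) :
    ∃ conn, IsConnection (m := m) (secEval m F V) conn := by
  have := ChartedSpace.locallyCompactSpace (EuclideanSpace ℝ (Fin m)) M
  have h := isSectionModule_section (m := m) (V := V) hF
  choose e c U hU hxU _ hs using fun a : M => exists_local_dual_basis (m := m) (F := F) (V := V) a
  obtain ⟨ρ, hρ⟩ := SmoothPartitionOfUnity.exists_isSubordinate (𝓡 m)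
    (isClosed_univ (X := M)) U hU fun x _ => Set.mem_iUnion.2 ⟨x, hxU x⟩
  let loc : Derivation ℝ (SmoothFun m M) (SmoothFun m M) → M → Module.End ℝ (SmoothSec m F V) :=
    fun D a =>
    { toFun := fun s => ∑ i, D (c a i s) • e a i
      map_add' := fun s t => by simp only [map_add, add_smul, Finset.sum_add_distrib]
      map_smul' := fun r s => by
        rw [RingHom.id_apply, Finset.smul_sum]
        refine Finset.sum_congr rfl fun i _ => ?_
        rw [← algebraMap_smul (SmoothFun m M) r s, map_smul, algebraMap_smul, D.map_smul,
          smul_assoc] }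
  choose conn hconn using fun D => h.exists_isGlue ρ (loc D)
  have hval : ∀ D s x, secEval m F V x (conn D s)
      = ∑ a ∈ ρ.finsupport x, ρ a x • ∑ i, D (c a i s) x • e a i x := fun D s x => by
    rw [hconn D s x]
    refine Finset.sum_congr rfl fun a _ => ?_
    congr 1
    exact sum_section_apply _ _ x
  refine ⟨conn, fun D f => h.end_ext fun s x => ?_, fun s x => ?_⟩
  · have h1 : ad ℝ (SmoothSec m F V) f (conn D) s = conn D (f • s) - f • conn D s := rfl
    rw [h1, map_sub, h.ev_γ, h.ev_smul, hval, hval, Finset.smul_sum, ← Finset.sum_sub_distrib]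
    have h2 : ∀ a ∈ ρ.finsupport x, ρ a x • ∑ i, D (c a i (f • s)) x • e a i x
        - f x • ρ a x • ∑ i, D (c a i s) x • e a i x = ρ a x • D f x • s x := by
      intro a ha
      have hxa : x ∈ U a := hρ a (subset_tsupport _ ((ρ.mem_finsupport x).1 ha))
      rw [smul_comm (f x), ← smul_sub, hs a s x hxa, Finset.smul_sum, Finset.smul_sum,
        ← Finset.sum_sub_distrib]
      congr 1
      refine Finset.sum_congr rfl fun i _ => ?_
      rw [map_smul, smul_eq_mul, D.leibniz, smul_smul, smul_smul, ← sub_smul]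
      congr 1
      change f x * D (c a i s) x + c a i s x * D f x - f x * D (c a i s) x = _
      ring
    rw [Finset.sum_congr rfl h2, ← Finset.sum_smul, ρ.sum_finsupport x (Set.mem_univ x), one_smul]
    rfl
  · let E := Fintype.equivFin (ρ.finsupport x × Fin (Module.finrank ℝ F))
    refine ⟨_, fun j => c (E.symm j).1 (E.symm j).2 s,
      fun j => ρ (E.symm j).1 x • e (E.symm j).1 (E.symm j).2 x, fun D => ?_⟩
    rw [hval, E.symm.sum_comp fun j => D (c j.1 j.2 s) x • ρ j.1 x • e j.1 j.2 x,
      Fintype.sum_prod_type, ← Finset.sum_coe_sort]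
    refine Finset.sum_congr rfl fun a _ => ?_
    rw [Finset.smul_sum]
    exact Finset.sum_congr rfl fun i _ => smul_comm _ _ _

end Sections

end SymbolAlgebra

end

theorem mainTheorem3 {m : ℕ} {M : Type*} [TopologicalSpace M]
    [ChartedSpace (EuclideanSpace ℝ (Fin m)) M] [IsManifold (𝓡 m) ∞ M]
    [T2Space M] [SecondCountableTopology M]
    {F : Type*} [NormedAddCommGroup F] [NormedSpace ℝ F] [FiniteDimensional ℝ F]
    (hF : 1 < Module.finrank ℝ F)
    {V : M → Type*} [TopologicalSpace (Bundle.TotalSpace F V)]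
    [∀ x, AddCommGroup (V x)] [∀ x, Module ℝ (V x)] [∀ x, TopologicalSpace (V x)]
    [FiberBundle F V] [VectorBundle ℝ F V] [ContMDiffVectorBundle ∞ F V (𝓡 m)] :
    -- `S(M) ≅ Pol(T*M)` via the principal symbol of scalar differential operators
    (∃ τ : SymbolAlgebra.Symbols ℝ (SymbolAlgebra.SmoothFun m M) (SymbolAlgebra.SmoothFun m M)
        ≃ₐ[ℝ] SymbolAlgebra.PolAlg m M, SymbolAlgebra.IsPrincipalSymbolMap τ.toAlgHom) ∧
    -- the principal symbol homomorphism `δ` from `S(P(E,M))` onto `Pol(T*M)`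
    ∃ δ : SymbolAlgebra.Symbols ℝ (SymbolAlgebra.SmoothFun m M) (SymbolAlgebra.SmoothSec m F V)
        →ₐ[ℝ] SymbolAlgebra.PolAlg m M,
      SymbolAlgebra.IsPrincipalSymbolMap δ ∧
      (∀ δ', SymbolAlgebra.IsPrincipalSymbolMap δ' → δ' = δ) ∧
      Function.Surjective δ ∧
      -- the ideal `J(E)`
      ∃ J : Ideal (SymbolAlgebra.Symbols ℝ (SymbolAlgebra.SmoothFun m M)
          (SymbolAlgebra.SmoothSec m F V)),
        (∀ P, P ∈ J ↔ P ^ 2 = 0) ∧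
        (∀ P ∈ J, ∀ Q ∈ J, P * Q = 0) ∧
        J = RingHom.ker δ ∧
        -- the splitting of `δ` by a homomorphism of graded algebras
        ∃ σ : SymbolAlgebra.PolAlg m M →ₐ[ℝ]
            SymbolAlgebra.Symbols ℝ (SymbolAlgebra.SmoothFun m M) (SymbolAlgebra.SmoothSec m F V),
          (∀ (k : ℕ) (p : SymbolAlgebra.Pol m M k), ∃ P, σ (DirectSum.of _ k p) =
            DirectSum.of (SymbolAlgebra.SymbolSpace ℝ (SymbolAlgebra.SmoothFun m M)
              (SymbolAlgebra.SmoothSec m F V)) k P) ∧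
          δ.comp σ = AlgHom.id ℝ (SymbolAlgebra.PolAlg m M) ∧
          IsCompl (J.restrictScalars ℝ) (Subalgebra.toSubmodule σ.range) := by

  have hA := SymbolAlgebra.isSectionModule_smoothFun (m := m) (M := M)
  have hcA := SymbolAlgebra.isConnection_smoothFun (m := m) (M := M)
  have h := SymbolAlgebra.isSectionModule_section (m := m) (V := V) (zero_lt_one.trans hF)
  obtain ⟨conn, hc⟩ := SymbolAlgebra.exists_isConnection_section (m := m) (V := V)
    (zero_lt_one.trans hF)
  refine ⟨⟨AlgEquiv.ofBijective hA.symbolHom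
    ⟨hA.symbolHom_injective SymbolAlgebra.orderLT_one_le_smoothFun, hcA.symbolHom_surjective hA⟩,
    hA.isPrincipalSymbolMap_symbolHom⟩, h.symbolHom, h.isPrincipalSymbolMap_symbolHom,
    fun _ => h.eq_symbolHom, hc.symbolHom_surjective h, RingHom.ker h.symbolHom,
    fun _ => h.sq_eq_zero_iff.symm, fun _ hP _ hQ => h.mul_eq_zero_of_symbolHom_eq_zero hP hQ, rfl,
    hc.splitHom h, fun _ p => ⟨_, hc.splitHom_of h p⟩, hc.symbolHom_comp_splitHom h,
    hc.isCompl_ker_range h⟩
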